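/- Let $n\ge 0$ and let $D$ be a diagram, i.e. a subset of the grid $[n]\times[n]$ of boxes $(i,j)$ (row $i$, column $j$, matrix coordinates), with columns $D_j=\{i:(i,j)\in D\}$. A configuration is written as a list of rows from top to bottom, each giving the entries in a left and a right column, where $\times$ means that the box is absent from $D$, $\square$ that it is present, and $*$ that there is no restriction. The six multiplicitous configurations are $$ \begin{aligned} (A)&:\ \times\times,\ \square\times,\ {*}\square; & (B)&:\ \times\square,\ \times\times,\ \square\square,\ \square{*}; & (C)&:\ \times\times,\ \times\times,\ \square\square,\ \square{*};\\ (D)&:\ \times\square,\ \square\times,\ \square\square; & (E)&:\ \times\square,\ \square\times,\ \square\times,\ \times\square; & (F)&:\ \square\times,\ \times\square,\ \square\times,\ \times\square. \end{aligned} $$ (Configurations $(A)$ and $(D)$ may be drawn with an unrestricted fourth row ${*}{*}$; such a row imposes no condition and need not exist in the grid.) The diagram $D$ is multiplicity-free if there are no two columns $j_1<j_2$ and rows $i_1<i_2<i_3$ (for $(A)$, $(D)$) or $i_1<i_2<i_3<i_4$ (for the others) in $[n]$ such that the restriction of $D$ to these rows and columns is one of the six configurations or is obtained from one of them by swapping its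 two columns. Let $Y$ be the $n\times n$ upper-triangular matrix of variables $y_{ij}$ ($i\le j$), and let the group $B$ of invertible upper-triangular complex matrices act on $\mathbb C[Y]$ by $f(Y)\cdot b=f(b^{-1}Y)$. For $k$-element sets $R=\{r_1<\dots<r_k\}$ and $S=\{s_1<\dots<s_k\}$ in $[n]$ write $R\le S$ if $r_i\le s_i$ for all $i$, and let $Y^R_S$ be the submatrix of $Y$ with rows $R$ and columns $S$. For diagrams write $C\le D$ if $C_j\le D_j$ (in particular $|C_j|=|D_j|$) for all $j$. The flagged Weyl module is $$\mathcal M_D=\operatorname{Span}_{\mathbb C}\Big\{\prod_{j=1}^n\det\big(Y^{C_j}_{D_j}\big)\ :\ C\le D\Big\}\subseteq\mathbb C[Y].$$ Its character is $\operatorname{char}(\mathcal M_D)(x_1,\dots,x_n)=\operatorname{tr}\big(\operatorname{diag}(x_1,\dots,x_n):\mathcal M_D\to\mathcal M_D\big)$ for $x_i\in\mathbb C^\times$, and its dual character is the (unique) polynomial $\chi_D(x)$ with $\chi_D(x_1,\dots,x_n)=\operatorname{char}(\mathcal M_D)(x_1^{-1},\dots,x_n^{-1})$. **Theorem.** If $D$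 is multiplicity-free, then $\chi_D(x)$ is zero-one: each of its monomial coefficients is $0$ or $1$. -/

import Mathlib

/-- A diagram: a set of boxes `(i, j)` (row `i`, column `j`, matrix coordinates) in the
`n × n` grid. Rows and columns are indexed by `Fin n`, rows from top to bottom. -/
abbrev Diagram (n : ℕ) : Type := Finset (Fin n × Fin n)

/-- The `j`-th column `D_j` of a diagram, as a set of row indices. -/
def Diagram.col {n : ℕ} (D : Diagram n) (j : Fin n) : Finset (Fin n) :=
  Finset.univ.filter fun i => (i, j) ∈ D

/-! ### Multiplicitous configurations

Each of the predicates below concerns an ordered pair of columns `P`, `Q` (left, right), given by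
the sets of rows in which they have a box. Each row of a configuration is written on its own line:
`x` is the absence of a box, `o` the presence of a box, `*` no restriction. In the configurations
A and D a row `**` at the bottom, which imposes no condition, is left out. -/

/-- Configuration A: `xx / ox / *o`. -/
def ConfigA {n : ℕ} (P Q : Finset (Fin n)) : Prop :=
  ∃ i₁ i₂ i₃ : Fin n, i₁ < i₂ ∧ i₂ < i₃ ∧
    (i₁ ∉ P ∧ i₁ ∉ Q) ∧
    (i₂ ∈ P ∧ i₂ ∉ Q) ∧
    i₃ ∈ Q

/-- Configuration B: `xo / xx / oo / o*`. -/
def ConfigB {n : ℕ} (P Q : Finset (Fin n)) : Prop :=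
  ∃ i₁ i₂ i₃ i₄ : Fin n, i₁ < i₂ ∧ i₂ < i₃ ∧ i₃ < i₄ ∧
    (i₁ ∉ P ∧ i₁ ∈ Q) ∧
    (i₂ ∉ P ∧ i₂ ∉ Q) ∧
    (i₃ ∈ P ∧ i₃ ∈ Q) ∧
    i₄ ∈ P

/-- Configuration C: `xx / xx / oo / o*`. -/
def ConfigC {n : ℕ} (P Q : Finset (Fin n)) : Prop :=
  ∃ i₁ i₂ i₃ i₄ : Fin n, i₁ < i₂ ∧ i₂ < i₃ ∧ i₃ < i₄ ∧
    (i₁ ∉ P ∧ i₁ ∉ Q) ∧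
    (i₂ ∉ P ∧ i₂ ∉ Q) ∧
    (i₃ ∈ P ∧ i₃ ∈ Q) ∧
    i₄ ∈ P

/-- Configuration D: `xo / ox / oo`. -/
def ConfigD {n : ℕ} (P Q : Finset (Fin n)) : Prop :=
  ∃ i₁ i₂ i₃ : Fin n, i₁ < i₂ ∧ i₂ < i₃ ∧
    (i₁ ∉ P ∧ i₁ ∈ Q) ∧
    (i₂ ∈ P ∧ i₂ ∉ Q) ∧
    (i₃ ∈ P ∧ i₃ ∈ Q)

/-- Configuration E: `xo / ox / ox / xo`. -/
def ConfigE {n : ℕ} (P Q : Finset (Fin n)) : Prop :=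
  ∃ i₁ i₂ i₃ i₄ : Fin n, i₁ < i₂ ∧ i₂ < i₃ ∧ i₃ < i₄ ∧
    (i₁ ∉ P ∧ i₁ ∈ Q) ∧
    (i₂ ∈ P ∧ i₂ ∉ Q) ∧
    (i₃ ∈ P ∧ i₃ ∉ Q) ∧
    (i₄ ∉ P ∧ i₄ ∈ Q)

/-- Configuration F: `ox / xo / ox / xo`. -/
def ConfigF {n : ℕ} (P Q : Finset (Fin n)) : Prop :=
  ∃ i₁ i₂ i₃ i₄ : Fin n, i₁ < i₂ ∧ i₂ < i₃ ∧ i₃ < i₄ ∧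
    (i₁ ∈ P ∧ i₁ ∉ Q) ∧
    (i₂ ∉ P ∧ i₂ ∈ Q) ∧
    (i₃ ∈ P ∧ i₃ ∉ Q) ∧
    (i₄ ∉ P ∧ i₄ ∈ Q)

/-- The ordered pair of columns `P`, `Q` contains one of the six multiplicitous configurations. -/
def ContainsMultiplicitous {n : ℕ} (P Q : Finset (Fin n)) : Prop :=
  ConfigA P Q ∨ ConfigB P Q ∨ ConfigC P Q ∨ ConfigD P Q ∨ ConfigE P Q ∨ ConfigF P Q

/-- A diagram is multiplicitous if two of its columns `j₁ < j₂` contain a multiplicitous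
configuration, up to possibly swapping the two columns. -/
def Diagram.Multiplicitous {n : ℕ} (D : Diagram n) : Prop :=
  ∃ j₁ j₂ : Fin n, j₁ < j₂ ∧
    (ContainsMultiplicitous (D.col j₁) (D.col j₂) ∨
      ContainsMultiplicitous (D.col j₂) (D.col j₁))

/-- A diagram is multiplicity-free if it is not multiplicitous. -/
def Diagram.MultiplicityFree {n : ℕ} (D : Diagram n) : Prop := ¬ D.Multiplicitous

/-! ### The Gale order -/

/-- The Gale order: `R ≤ S` if `R = {r₁ < ⋯ < r_k}` and `S = {s₁ < ⋯ < s_k}` have the same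
cardinality and `r_i ≤ s_i` for all `i`. -/
def GaleLE {n : ℕ} (R S : Finset (Fin n)) : Prop :=
  ∃ h : R.card = S.card, ∀ i : Fin S.card, R.orderEmbOfFin h i ≤ S.orderEmbOfFin rfl i

/-- `C ≤ D` for diagrams: `C_j ≤ D_j` in the Gale order for every column `j`. -/
def Diagram.LE {n : ℕ} (C D : Diagram n) : Prop := ∀ j, GaleLE (C.col j) (D.col j)

/-! ### The polynomial ring `ℂ[Y]` and the action of the Borel subgroup -/

/-- The polynomial ring `ℂ[Y]` in the variables `y_{ij}`, `i ≤ j`. -/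
abbrev FlagPoly (n : ℕ) : Type := MvPolynomial {p : Fin n × Fin n // p.1 ≤ p.2} ℂ

/-- The upper-triangular matrix `Y` of variables. -/
noncomputable def genericUpper (n : ℕ) : Matrix (Fin n) (Fin n) (FlagPoly n) :=
  Matrix.of fun i j => if h : i ≤ j then MvPolynomial.X ⟨(i, j), h⟩ else 0

/-- The Borel subgroup `B` of invertible upper-triangular matrices. -/
def upperBorel (n : ℕ) : Subgroup (Matrix.GeneralLinearGroup (Fin n) ℂ) where
  carrier := {b | (b : Matrix (Fin n) (Fin n) ℂ).BlockTriangular id}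
  one_mem' := by simpa using Matrix.blockTriangular_one
  mul_mem' := by
    intro a b ha hb
    simpa using Matrix.BlockTriangular.mul ha hb
  inv_mem' := by
    intro b hb
    have := b.invertible
    simpa using Matrix.blockTriangular_inv_of_blockTriangular hb

/-- The (right) action `f(Y) · b = f(b⁻¹ Y)` of `b ∈ B` on `ℂ[Y]`: each variable `y_{ij}` is
replaced by the `(i, j)` entry of `b⁻¹ Y`. -/
noncomputable def borelAct {n : ℕ} (b : upperBorel n) : FlagPoly n →ₐ[ℂ] FlagPoly n :=
  let bInv : Matrix (Fin n) (Fin n) ℂ :=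
    ((b⁻¹ : upperBorel n) : Matrix.GeneralLinearGroup (Fin n) ℂ)
  let bInvY : Matrix (Fin n) (Fin n) (FlagPoly n) :=
    bInv.map (fun c => (MvPolynomial.C c : FlagPoly n)) * genericUpper n
  MvPolynomial.aeval fun p => bInvY p.1.1 p.1.2

/-- The diagonal matrix with diagonal entries `x_1, …, x_n`, an element of `B`. -/
noncomputable def torus {n : ℕ} (x : Fin n → ℂˣ) : upperBorel n :=
  ⟨{ val := Matrix.diagonal fun i => (x i : ℂ)
     inv := Matrix.diagonal fun i => ((x i)⁻¹ : ℂ)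
     val_inv := by simp
     inv_val := by simp },
    Matrix.blockTriangular_diagonal _⟩

/-! ### The flagged Weyl module -/

/-- The minor `det (Y_S^R)` of `Y` with rows `R` and columns `S`, for `R`, `S` of the same
cardinality. -/
noncomputable def flagMinor {n : ℕ} (R S : Finset (Fin n)) (h : R.card = S.card) : FlagPoly n :=
  ((genericUpper n).submatrix (R.orderEmbOfFin h) (S.orderEmbOfFin rfl)).det

/-- `det (Y_D^C) = ∏_j det (Y_{D_j}^{C_j})` for diagrams `C ≤ D`. -/
noncomputable def diagramDet {n : ℕ} (C D : Diagram n) (h : C.LE D) : FlagPoly n :=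
  ∏ j, flagMinor (C.col j) (D.col j) (h j).fst

/-- The flagged Weyl module `M_D`, the span of the polynomials `det (Y_D^C)` with `C ≤ D`. -/
noncomputable def flaggedWeyl {n : ℕ} (D : Diagram n) : Submodule ℂ (FlagPoly n) :=
  Submodule.span ℂ {f | ∃ (C : Diagram n) (h : C.LE D), f = diagramDet C D h}

theorem borelAct_torus_genericUpper {n : ℕ} (x : Fin n → ℂˣ) (i j : Fin n) :
    borelAct (torus x) (genericUpper n i j) =
      MvPolynomial.C ((x i)⁻¹ : ℂ) * genericUpper n i j := by
  by_cases h : i ≤ j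
  · have hinv : ((((torus x)⁻¹ : upperBorel n) : Matrix.GeneralLinearGroup (Fin n) ℂ) :
        Matrix (Fin n) (Fin n) ℂ) = Matrix.diagonal fun i => ((x i)⁻¹ : ℂ) := rfl
    have hY : genericUpper n i j = MvPolynomial.X ⟨(i, j), h⟩ := by simp [genericUpper, h]
    rw [hY, borelAct, MvPolynomial.aeval_X, hinv, Matrix.diagonal_map (map_zero _),
      Matrix.diagonal_mul, hY]
  · simp [genericUpper, h]

theorem borelAct_torus_flagMinor {n : ℕ} (x : Fin n → ℂˣ) (R S : Finset (Fin n))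
    (h : R.card = S.card) :
    ∃ c : ℂ, borelAct (torus x) (flagMinor R S h) = c • flagMinor R S h := by
  refine ⟨∏ k, ((x (R.orderEmbOfFin h k))⁻¹ : ℂ), ?_⟩
  rw [flagMinor, AlgHom.map_det, MvPolynomial.smul_eq_C_mul, map_prod, ← Matrix.det_mul_column]
  congr 1
  ext1 a b
  simp [borelAct_torus_genericUpper]

/-- `M_D` is stable under the action of the diagonal matrices. -/
theorem borelAct_torus_mem_flaggedWeyl {n : ℕ} (D : Diagram n) (x : Fin n → ℂˣ) :
    ∀ f ∈ flaggedWeyl D, (borelAct (torus x)).toLinearMap f ∈ flaggedWeyl D := by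
  intro f hf
  induction hf using Submodule.span_induction with
  | mem f hf =>
    obtain ⟨C, h, rfl⟩ := hf
    choose c hc using fun j => borelAct_torus_flagMinor x (C.col j) (D.col j) (h j).fst
    have : (borelAct (torus x)).toLinearMap (diagramDet C D h)
        = (∏ j, c j) • diagramDet C D h := by
      rw [AlgHom.toLinearMap_apply, diagramDet, map_prod, Finset.prod_congr rfl fun j _ => hc j,
        Finset.prod_smul]
    rw [this]
    exact Submodule.smul_mem _ _ (Submodule.subset_span ⟨C, h, rfl⟩)
  | zero => simp
  | add f g _ _ hf hg => rw [map_add]; exact Submodule.add_mem _ hf hg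
  | smul a f _ hf => rw [map_smul]; exact Submodule.smul_mem _ _ hf

instance {n : ℕ} (D : Diagram n) : FiniteDimensional ℂ (flaggedWeyl D) := by
  classical
  refine FiniteDimensional.span_of_finite ℂ
    ((Set.finite_range fun C : Diagram n =>
      if h : C.LE D then diagramDet C D h else 0).subset ?_)
  rintro f ⟨C, h, rfl⟩
  exact ⟨C, by simp [h]⟩

/-- The character `char(M_D)(x_1, …, x_n)`: the trace of the action of the diagonal matrix with
entries `x_1, …, x_n` on `M_D`. -/
noncomputable def weylCharacter {n : ℕ} (D : Diagram n) (x : Fin n → ℂˣ) : ℂ :=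
  LinearMap.trace ℂ (flaggedWeyl D)
    ((borelAct (torus x)).toLinearMap.restrict (borelAct_torus_mem_flaggedWeyl D x))

/-- `χ` is the dual character `χ_D` of `M_D`: the polynomial in `x_1, …, x_n` with
`χ(x_1, …, x_n) = char(M_D)(x_1⁻¹, …, x_n⁻¹)`. -/
def IsDualCharacter {n : ℕ} (D : Diagram n) (χ : MvPolynomial (Fin n) ℂ) : Prop :=
  ∀ x : Fin n → ℂˣ,
    MvPolynomial.eval (fun i => (x i : ℂ)) χ = weylCharacter D (fun i => (x i)⁻¹)

/-- A polynomial is zero-one if each of its coefficients is `0` or `1`. -/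
def IsZeroOne {n : ℕ} (p : MvPolynomial (Fin n) ℂ) : Prop :=
  ∀ a : Fin n →₀ ℕ, p.coeff a = 0 ∨ p.coeff a = 1

/-!
The polynomials `det (Y_D^C)` with `C ≤ D` are nonzero eigenvectors of the diagonal matrices, and
the weight of `det (Y_D^C)` in the dual character is the monomial recording the number of boxes of
`C` in each row. So the dual character is the sum of the monomials of all weights, with the
dimensions of the weight spaces as coefficients, and it has to be shown that two polynomials
`det (Y_D^C)`, `det (Y_D^C')` of equal weight agree up to a unit of `ℂ[Y]`
(`associated_diagramDet`). This takes two steps.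

The first is valid for all diagrams. Two diagrams `C, C' ≤ D` of equal weight are connected by
exchanges within `{C ≤ D}`, each of which moves a box from row `u` to row `v` in one column and a
box from `v` to `u` in another (`rel_of_rowSum_eq`). In terms of the counting functions
`below R t = #{r ∈ R | r < t}` the Gale order is a pointwise inequality. The rows in which `C` and
`C'` differ carry a directed graph, with an edge from `u` to `v` if `C'` looks as if a box of `C` had
been moved from `u` to `v` in some column. On a minimal set of rows closed under leaving along some
edge this graph is a cycle without chords, and at its top row one finds an exchange, in `C` or in
`C'`, which decreases the area between the counting functions (`exists_exchange`).

The second step concerns two columns which contain none of the six configurations, and shows that an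
exchange between them preserves the product of the two minors up to a unit
(`associated_minor_exchange`). An exchange of `u < v` is possible only if both columns have room
between `u` and `v`; by D, E, F some row `g ≤ u` is then missing in both, by A the columns agree
below `g` until one of them ends, and by B, C they are so rigid there that both minors, which are
block triangular, have a factor with the same columns, and these two factors are merely
interchanged.
-/

/-! ### Minors up to units -/

theorem genericUpper_eq_zero {n : ℕ} {i j : Fin n} (h : j < i) : genericUpper n i j = 0 := by
  simp [genericUpper, not_le.mpr h]

/-- Up to a unit (a sign), a minor may be computed with any enumeration of its rows and columns. -/
theorem associated_flagMinor_det {n : ℕ} {ι : Type*} [Fintype ι] [DecidableEq ι]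
    {R S : Finset (Fin n)} (h : R.card = S.card) {r c : ι → Fin n} (hr : Function.Injective r)
    (hc : Function.Injective c) (hR : Finset.univ.image r = R) (hS : Finset.univ.image c = S) :
    Associated (flagMinor R S h) ((genericUpper n).submatrix r c).det := by
  classical
  let eR : ι ≃ R := Equiv.ofBijective (fun i => ⟨r i, by rw [← hR]; simp⟩)
    ⟨fun a b hab => hr (by simpa using hab), fun ⟨x, hx⟩ => by
      rw [← hR] at hx
      obtain ⟨i, -, rfl⟩ := Finset.mem_image.mp hx
      exact ⟨i, rfl⟩⟩
  let eS : ι ≃ S := Equiv.ofBijective (fun i => ⟨c i, by rw [← hS]; simp⟩)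
    ⟨fun a b hab => hc (by simpa using hab), fun ⟨x, hx⟩ => by
      rw [← hS] at hx
      obtain ⟨i, -, rfl⟩ := Finset.mem_image.mp hx
      exact ⟨i, rfl⟩⟩
  let τ := (R.orderIsoOfFin h).toEquiv
  let σ := (S.orderIsoOfFin rfl).toEquiv
  let e : Fin S.card ≃ ι := σ.trans eS.symm
  let π : Equiv.Perm (Fin S.card) := (e.trans eR).trans τ.symm
  have key : ((genericUpper n).submatrix r c).submatrix e e =
      ((genericUpper n).submatrix (R.orderEmbOfFin h) (S.orderEmbOfFin rfl)).submatrix π id := by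
    ext1 a b
    have h1 : r (e a) = R.orderEmbOfFin h (π a) := by
      have : τ (π a) = eR (e a) := by simp [π]
      have := congrArg Subtype.val this
      exact this.symm
    have h2 : c (e b) = S.orderEmbOfFin rfl b := by
      have : eS (e b) = σ b := by simp [e]
      exact congrArg Subtype.val this
    simp [h1, h2]
  rw [← Matrix.det_submatrix_equiv_self e, key, Matrix.det_permute, flagMinor]
  refine (associated_unit_mul_left _ _ ?_).symm
  exact (Units.map (Int.castRingHom (FlagPoly n)).toMonoidHom (Equiv.Perm.sign π)).isUnit

/-- The minor with rows `R` and columns `S`, extended by the junk value `0` to sets of different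
cardinalities. -/
noncomputable def minor {n : ℕ} (R S : Finset (Fin n)) : FlagPoly n :=
  if h : R.card = S.card then flagMinor R S h else 0

theorem minor_eq {n : ℕ} {R S : Finset (Fin n)} (h : R.card = S.card) :
    minor R S = flagMinor R S h := dif_pos h

/-- A minor of the upper triangular matrix `Y` is block triangular, hence a product of two smaller
minors, as soon as all rows of the second block lie strictly below all columns of the first. -/
theorem associated_minor_union {n : ℕ} {R₀ R₁ S₀ S₁ : Finset (Fin n)} (hR : Disjoint R₀ R₁)
    (hS : Disjoint S₀ S₁) (h₀ : R₀.card = S₀.card) (h₁ : R₁.card = S₁.card)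
    (hlt : ∀ s ∈ S₀, ∀ r ∈ R₁, s < r) :
    Associated (minor (R₀ ∪ R₁) (S₀ ∪ S₁)) (minor R₀ S₀ * minor R₁ S₁) := by
  classical
  have hcard : (R₀ ∪ R₁).card = (S₀ ∪ S₁).card := by
    rw [Finset.card_union_of_disjoint hR, Finset.card_union_of_disjoint hS, h₀, h₁]
  rw [minor_eq hcard, minor_eq h₀, minor_eq h₁]
  have inj : ∀ {A B : Finset (Fin n)} {a b : ℕ} (hAB : Disjoint A B) (hA : A.card = a)
      (hB : B.card = b),
      Function.Injective (Sum.elim (A.orderEmbOfFin hA) (B.orderEmbOfFin hB)) := by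
    intro A B a b hAB hA hB
    refine Function.Injective.sumElim (A.orderEmbOfFin hA).injective
      (B.orderEmbOfFin hB).injective fun i j hij => ?_
    exact Finset.disjoint_left.mp hAB (A.orderEmbOfFin_mem hA i)
      (hij ▸ B.orderEmbOfFin_mem hB j)
  have im : ∀ {A B : Finset (Fin n)} {a b : ℕ} (hA : A.card = a) (hB : B.card = b),
      Finset.univ.image (Sum.elim (A.orderEmbOfFin hA) (B.orderEmbOfFin hB)) = A ∪ B := by
    intro A B a b hA hB
    ext x
    have h1 := Set.ext_iff.mp (A.range_orderEmbOfFin hA) x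
    have h2 := Set.ext_iff.mp (B.range_orderEmbOfFin hB) x
    simp only [Set.mem_range, SetLike.mem_coe] at h1 h2
    simp [h1, h2]
  refine (associated_flagMinor_det hcard (inj hR h₀ h₁) (inj hS rfl rfl) (im _ _)
    (im _ _)).trans ?_
  have hblock : (genericUpper n).submatrix
      (Sum.elim (R₀.orderEmbOfFin h₀) (R₁.orderEmbOfFin h₁))
      (Sum.elim (S₀.orderEmbOfFin rfl) (S₁.orderEmbOfFin rfl)) =
      Matrix.fromBlocks
        ((genericUpper n).submatrix (R₀.orderEmbOfFin h₀) (S₀.orderEmbOfFin rfl))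
        ((genericUpper n).submatrix (R₀.orderEmbOfFin h₀) (S₁.orderEmbOfFin rfl)) 0
        ((genericUpper n).submatrix (R₁.orderEmbOfFin h₁) (S₁.orderEmbOfFin rfl)) := by
    ext1 a b
    rcases a with a | a <;> rcases b with b | b <;> simp
    exact genericUpper_eq_zero (hlt _ (S₀.orderEmbOfFin_mem rfl b) _ (R₁.orderEmbOfFin_mem h₁ a))
  rw [hblock, Matrix.det_fromBlocks_zero₂₁]
  rfl

/-- If `R ≤ S` in the Gale order, the substitution `y_{r_i s_i} = 1`, all other variables `0`,
turns the minor into the determinant of the identity matrix. -/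
theorem flagMinor_ne_zero {n : ℕ} {R S : Finset (Fin n)} (h : GaleLE R S) :
    flagMinor R S h.fst ≠ 0 := by
  classical
  intro h0
  set r := R.orderEmbOfFin h.fst
  set s := S.orderEmbOfFin rfl
  let φ : FlagPoly n →ₐ[ℂ] ℂ :=
    MvPolynomial.aeval fun p => if ∃ i, r i = p.1.1 ∧ s i = p.1.2 then (1 : ℂ) else 0
  have hφ : φ (flagMinor R S h.fst) = 1 := by
    have : φ.mapMatrix ((genericUpper n).submatrix r s) = 1 := by
      ext a b
      simp only [AlgHom.mapMatrix_apply, Matrix.map_apply, Matrix.submatrix_apply]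
      by_cases hab : a = b
      · subst hab
        have hle : r a ≤ s a := h.snd a
        simp only [genericUpper, Matrix.of_apply, hle, dif_pos, Matrix.one_apply_eq]
        rw [MvPolynomial.aeval_X, if_pos ⟨a, rfl, rfl⟩]
      · rw [Matrix.one_apply_ne hab]
        simp only [genericUpper, Matrix.of_apply]
        split_ifs with hle
        · rw [MvPolynomial.aeval_X, if_neg]
          rintro ⟨i, h1, h2⟩
          exact hab ((r.injective h1).symm.trans (s.injective h2))
        · simp
    rw [flagMinor, AlgHom.map_det, this, Matrix.det_one]
  rw [h0, map_zero] at hφ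
  exact zero_ne_one hφ

/-! ### The Gale order through counting functions -/

/-- The number of elements of `R` among the first `t` rows. -/
def below {n : ℕ} (R : Finset (Fin n)) (t : ℕ) : ℕ := (R.filter fun r : Fin n => (r : ℕ) < t).card

theorem below_zero {n : ℕ} (R : Finset (Fin n)) : below R 0 = 0 := by simp [below]

theorem below_of_le {n : ℕ} (R : Finset (Fin n)) {t : ℕ} (h : ∀ r ∈ R, (r : ℕ) < t) :
    below R t = R.card := by
  rw [below, Finset.filter_true_of_mem h]

theorem below_last {n : ℕ} (R : Finset (Fin n)) : below R n = R.card :=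
  below_of_le R fun r _ => r.2

theorem below_le_card {n : ℕ} (R : Finset (Fin n)) (t : ℕ) : below R t ≤ R.card :=
  Finset.card_filter_le _ _

theorem below_succ {n : ℕ} (R : Finset (Fin n)) (i : Fin n) :
    below R (i + 1) = below R i + if i ∈ R then 1 else 0 := by
  have h : (R.filter fun r : Fin n => (r : ℕ) < i + 1) =
      (R.filter fun r : Fin n => (r : ℕ) < i) ∪ R.filter fun r : Fin n => r = i := by
    rw [← Finset.filter_or]
    refine Finset.filter_congr fun r _ => ?_
    rw [Nat.lt_succ_iff_lt_or_eq, Fin.ext_iff]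
  rw [below, h, Finset.card_union_of_disjoint, below, Finset.filter_eq']
  · split_ifs <;> simp
  · refine Finset.disjoint_filter.mpr fun r _ h1 h2 => ?_
    subst h2
    exact lt_irrefl _ h1

theorem below_le {n : ℕ} (R : Finset (Fin n)) (t : ℕ) : below R t ≤ t := by
  have : (R.filter fun r : Fin n => (r : ℕ) < t).card ≤ (Finset.range t).card :=
    Finset.card_le_card_of_injOn (fun r => (r : ℕ))
      (fun r hr => by simpa using (Finset.mem_filter.mp hr).2)
      (fun a _ b _ h => Fin.ext h)
  simpa [below] using this

theorem below_insert {n : ℕ} {R : Finset (Fin n)} {i : Fin n} (h : i ∉ R) (t : ℕ) :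
    below (insert i R) t = below R t + if (i : ℕ) < t then 1 else 0 := by
  rw [below, Finset.filter_insert]
  split_ifs
  · rw [Finset.card_insert_of_notMem (fun h' => h (Finset.mem_filter.mp h').1), below]
  · rfl

theorem below_erase {n : ℕ} {R : Finset (Fin n)} {i : Fin n} (h : i ∈ R) (t : ℕ) :
    below (R.erase i) t + (if (i : ℕ) < t then 1 else 0) = below R t := by
  rw [← below_insert (Finset.notMem_erase i R), Finset.insert_erase h]

theorem below_orderEmb {n k : ℕ} {R : Finset (Fin n)} (h : R.card = k) (t : ℕ) :
    below R t = (Finset.univ.filter fun i : Fin k => (R.orderEmbOfFin h i : ℕ) < t).card := by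
  rw [below, ← Finset.card_map (R.orderEmbOfFin h).toEmbedding]
  congr 1
  ext x
  have hx := Set.ext_iff.mp (R.range_orderEmbOfFin h) x
  simp only [Set.mem_range, SetLike.mem_coe] at hx
  simp only [Finset.mem_filter, ← hx, Finset.mem_map, Finset.mem_univ, true_and,
    RelEmbedding.coe_toEmbedding]
  constructor
  · rintro ⟨⟨i, rfl⟩, h2⟩
    exact ⟨i, h2, rfl⟩
  · rintro ⟨i, h2, rfl⟩
    exact ⟨⟨i, rfl⟩, h2⟩

theorem galeLE_iff_below {n : ℕ} {R S : Finset (Fin n)} :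
    GaleLE R S ↔ R.card = S.card ∧ ∀ t, below S t ≤ below R t := by
  constructor
  · rintro ⟨h, hle⟩
    refine ⟨h, fun t => ?_⟩
    rw [below_orderEmb h, below_orderEmb rfl]
    refine Finset.card_le_card fun i hi => ?_
    simp only [Finset.mem_filter, Finset.mem_univ, true_and] at hi ⊢
    exact lt_of_le_of_lt (hle i) hi
  · rintro ⟨h, hle⟩
    refine ⟨h, fun i => ?_⟩
    by_contra! hlt
    have h1 := hle (S.orderEmbOfFin rfl i + 1)
    rw [below_orderEmb h, below_orderEmb rfl] at h1
    have h2 : (Finset.Iic i).card ≤ (Finset.univ.filter fun k : Fin S.card =>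
        (S.orderEmbOfFin rfl k : ℕ) < S.orderEmbOfFin rfl i + 1).card := by
      refine Finset.card_le_card fun k hk => ?_
      simp only [Finset.mem_filter, Finset.mem_univ, true_and, Finset.mem_Iic,
        Nat.lt_succ_iff] at hk ⊢
      exact (S.orderEmbOfFin rfl).monotone hk
    have h3 : (Finset.univ.filter fun k : Fin S.card =>
        (R.orderEmbOfFin h k : ℕ) < S.orderEmbOfFin rfl i + 1).card ≤ (Finset.Iio i).card := by
      refine Finset.card_le_card fun k hk => ?_
      simp only [Finset.mem_filter, Finset.mem_univ, true_and, Finset.mem_Iio,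
        Nat.lt_succ_iff] at hk ⊢
      exact (R.orderEmbOfFin h).lt_iff_lt.mp (lt_of_le_of_lt hk hlt)
    rw [Fin.card_Iic] at h2
    rw [Fin.card_Iio] at h3
    omega

/-! ### Exchanging one element -/

/-- Replace the element `u` of `R` by `v`. -/
def move {n : ℕ} (R : Finset (Fin n)) (u v : Fin n) : Finset (Fin n) := insert v (R.erase u)

theorem mem_move {n : ℕ} {R : Finset (Fin n)} {u v i : Fin n} :
    i ∈ move R u v ↔ i = v ∨ (i ≠ u ∧ i ∈ R) := by simp [move]

theorem card_move {n : ℕ} {R : Finset (Fin n)} {u v : Fin n} (hu : u ∈ R) (hv : v ∉ R) :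
    (move R u v).card = R.card := by
  rw [move, Finset.card_insert_of_notMem (fun h => hv (Finset.mem_of_mem_erase h)),
    Finset.card_erase_add_one hu]

theorem move_move {n : ℕ} {R : Finset (Fin n)} {u v : Fin n} (hu : u ∈ R) (hv : v ∉ R) :
    move (move R u v) v u = R := by
  ext i
  simp only [mem_move]
  by_cases h1 : i = u
  · simp [h1, hu]
  · by_cases h2 : i = v
    · simp only [h2, hv]
      simp
      rintro rfl
      exact hv hu
    · simp [h1, h2]

/-- Moving `u` to `v` lowers the counting function by one at the times in `(u, v]`. -/
theorem below_move {n : ℕ} {R : Finset (Fin n)} {u v : Fin n} (huv : u < v) (hu : u ∈ R)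
    (hv : v ∉ R) (t : ℕ) :
    below (move R u v) t + (if (u : ℕ) < t ∧ t ≤ v then 1 else 0) = below R t := by
  have h1 := below_erase hu t
  have h2 := below_insert (fun h => hv (Finset.mem_of_mem_erase h) : v ∉ R.erase u) t
  rw [move, h2]
  have : (u : ℕ) < v := huv
  split_ifs at * <;> omega

theorem below_move' {n : ℕ} {R : Finset (Fin n)} {u v : Fin n} (huv : u < v) (hu : u ∉ R)
    (hv : v ∈ R) (t : ℕ) :
    below (move R v u) t = below R t + if (u : ℕ) < t ∧ t ≤ v then 1 else 0 := by
  have h1 := below_erase hv t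
  have h2 := below_insert (fun h => hu (Finset.mem_of_mem_erase h) : u ∉ R.erase v) t
  rw [move, h2]
  have : (u : ℕ) < v := huv
  split_ifs at * <;> omega

theorem GaleLE.move_up {n : ℕ} {R S : Finset (Fin n)} (h : GaleLE R S) {u v : Fin n} (huv : u < v)
    (hu : u ∉ R) (hv : v ∈ R) : GaleLE (move R v u) S := by
  rw [galeLE_iff_below] at h ⊢
  refine ⟨(card_move hv hu).trans h.1, fun t => ?_⟩
  rw [below_move' huv hu hv]
  exact (h.2 t).trans (Nat.le_add_right _ _)

theorem galeLE_move_down_iff {n : ℕ} {R S : Finset (Fin n)} (h : GaleLE R S) {u v : Fin n}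
    (huv : u < v) (hu : u ∈ R) (hv : v ∉ R) :
    GaleLE (move R u v) S ↔ ∀ t : ℕ, u < t → t ≤ v → below S t + 1 ≤ below R t := by
  rw [galeLE_iff_below] at h ⊢
  constructor
  · rintro ⟨-, h2⟩ t h3 h4
    have := h2 t
    have h5 := below_move huv hu hv t
    rw [if_pos ⟨h3, h4⟩] at h5
    omega
  · refine fun h2 => ⟨(card_move hu hv).trans h.1, fun t => ?_⟩
    have h5 := below_move huv hu hv t
    have := h.2 t
    split_ifs at h5 with h6
    · have := h2 t h6.1 h6.2
      omega
    · omega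

/-! ### Connecting families of sets with the same row sums by exchanges -/

section Connectivity

variable {n : ℕ} {ι : Type*}

/-- Exchange `u ∈ C j` against `v ∈ C k`. -/
def exchange [DecidableEq ι] (C : ι → Finset (Fin n)) (j k : ι) (u v : Fin n) :
    ι → Finset (Fin n) :=
  Function.update (Function.update C j (move (C j) u v)) k (move (C k) v u)

/-- `u ∈ C j` may be exchanged against `v ∈ C k`, where `u < v`, within the families bounded
by `D`. -/
structure Exchangeable (D C : ι → Finset (Fin n)) (j k : ι) (u v : Fin n) : Prop where
  lt : u < v
  mem_left : u ∈ C j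
  notMem_left : v ∉ C j
  mem_right : v ∈ C k
  notMem_right : u ∉ C k
  slack : ∀ t : ℕ, u < t → t ≤ v → below (D j) t + 1 ≤ below (C j) t

theorem Exchangeable.ne {D C : ι → Finset (Fin n)} {j k : ι} {u v : Fin n}
    (h : Exchangeable D C j k u v) : j ≠ k := by
  rintro rfl
  exact h.notMem_right h.mem_left

theorem Exchangeable.galeLE [DecidableEq ι] {D C : ι → Finset (Fin n)} {j k : ι} {u v : Fin n}
    (h : Exchangeable D C j k u v) (hC : ∀ i, GaleLE (C i) (D i)) (i : ι) :
    GaleLE (exchange C j k u v i) (D i) := by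
  unfold exchange
  by_cases hk : i = k
  · subst hk
    rw [Function.update_self]
    exact (hC i).move_up h.lt h.notMem_right h.mem_right
  · rw [Function.update_of_ne hk]
    by_cases hj : i = j
    · subst hj
      rw [Function.update_self]
      exact (galeLE_move_down_iff (hC i) h.lt h.mem_left h.notMem_left).mpr h.slack
    · rw [Function.update_of_ne hj]
      exact hC i

theorem exchange_left [DecidableEq ι] {C : ι → Finset (Fin n)} {j k : ι} (hjk : j ≠ k)
    (u v : Fin n) : exchange C j k u v j = move (C j) u v := by simp [exchange, hjk]

theorem exchange_right [DecidableEq ι] {C : ι → Finset (Fin n)} {j k : ι} (u v : Fin n) :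
    exchange C j k u v k = move (C k) v u := by simp [exchange]

theorem exchange_of_ne [DecidableEq ι] {C : ι → Finset (Fin n)} {i j k : ι} (hj : i ≠ j)
    (hk : i ≠ k) (u v : Fin n) : exchange C j k u v i = C i := by simp [exchange, hj, hk]

/-- The number of sets of the family containing `i`. -/
def rowSum [Fintype ι] (C : ι → Finset (Fin n)) (i : Fin n) : ℕ :=
  (Finset.univ.filter fun j => i ∈ C j).card

theorem rowSum_eq_sum [Fintype ι] (C : ι → Finset (Fin n)) (i : Fin n) :
    rowSum C i = ∑ j, if i ∈ C j then 1 else 0 := by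
  rw [rowSum, Finset.card_filter]

@[to_additive]
theorem prod_eq_mul_mul_prod [Fintype ι] [DecidableEq ι] {M : Type*} [CommMonoid M] (f : ι → M)
    {j k : ι} (hjk : j ≠ k) :
    ∏ i, f i = f j * f k * ∏ i ∈ (Finset.univ.erase j).erase k, f i := by
  rw [← Finset.mul_prod_erase _ f (Finset.mem_univ j),
    ← Finset.mul_prod_erase _ f (Finset.mem_erase.mpr ⟨hjk.symm, Finset.mem_univ k⟩), mul_assoc]

theorem Exchangeable.rowSum [Fintype ι] [DecidableEq ι] {D C : ι → Finset (Fin n)}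
    {j k : ι} {u v : Fin n} (h : Exchangeable D C j k u v) (i : Fin n) :
    rowSum (exchange C j k u v) i = rowSum C i := by
  rw [rowSum_eq_sum, rowSum_eq_sum, sum_eq_add_add_sum _ h.ne,
    sum_eq_add_add_sum (fun a => if i ∈ C a then 1 else 0) h.ne]
  congr 1
  · rw [exchange_left h.ne, exchange_right]
    simp only [mem_move]
    have h1 := h.mem_left
    have h2 := h.notMem_left
    have h3 := h.mem_right
    have h4 := h.notMem_right
    have h5 := h.lt.ne
    by_cases hu : i = u
    · subst hu; simp [*]
    · by_cases hv : i = v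
      · subst hv; simp [*]
      · simp [hu, hv]
  · refine Finset.sum_congr rfl fun a ha => ?_
    simp only [Finset.mem_erase] at ha
    rw [exchange_of_ne ha.2.1 ha.1]

/-- The distance of two families: the total `ℓ¹`-distance of their counting functions. -/
def area [Fintype ι] (C C' : ι → Finset (Fin n)) : ℕ :=
  ∑ j, ∑ t ∈ Finset.range (n + 1), ((below (C j) t : ℤ) - below (C' j) t).natAbs

theorem area_comm [Fintype ι] (C C' : ι → Finset (Fin n)) : area C C' = area C' C :=
  Finset.sum_congr rfl fun j _ => Finset.sum_congr rfl fun t _ => by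
    rw [← Int.natAbs_neg, neg_sub]

/-- An exchange which moves both columns towards `C'` at all times in `(u, v]` shrinks the area. -/
theorem Exchangeable.area_lt [Fintype ι] [DecidableEq ι] {D C C' : ι → Finset (Fin n)}
    {j k : ι} {u v : Fin n} (h : Exchangeable D C j k u v)
    (hj : ∀ t : ℕ, u < t → t ≤ v → below (C' j) t < below (C j) t)
    (hk : ∀ t : ℕ, u < t → t ≤ v → below (C k) t < below (C' k) t) :
    area (exchange C j k u v) C' < area C C' := by
  have hn : ∀ i, ∀ t ∈ Finset.range (n + 1),
      ((below (exchange C j k u v i) t : ℤ) - below (C' i) t).natAbs ≤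
        ((below (C i) t : ℤ) - below (C' i) t).natAbs := by
    intro i t _
    by_cases hik : i = k
    · subst hik
      rw [exchange_right, below_move' h.lt h.notMem_right h.mem_right]
      split_ifs with ht
      · have := hk t ht.1 ht.2
        omega
      · simp
    · by_cases hij : i = j
      · subst hij
        rw [exchange_left h.ne]
        have h1 := below_move h.lt h.mem_left h.notMem_left t
        split_ifs at h1 with ht
        · have := hj t ht.1 ht.2
          omega
        · omega
      · rw [exchange_of_ne hij hik]
  refine Finset.sum_lt_sum (fun i _ => Finset.sum_le_sum (hn i)) ⟨j, Finset.mem_univ j, ?_⟩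
  refine Finset.sum_lt_sum (hn j) ⟨v, ?_, ?_⟩
  · have := v.2
    simp
  · rw [exchange_left h.ne]
    have h1 := below_move h.lt h.mem_left h.notMem_left v
    have huv : (u : ℕ) < v := h.lt
    rw [if_pos ⟨huv, le_rfl⟩] at h1
    have := hj v huv le_rfl
    omega

/-- Column `m` contains `u` in `C` only, `v` in `C'` only, and the counting functions of `C` and
`C'` compare, strictly between the two rows, as if `C'` arose from `C` by moving `u` to `v`. -/
def Shift (C C' : ι → Finset (Fin n)) (m : ι) (u v : Fin n) : Prop :=
  (u ∈ C m ∧ u ∉ C' m) ∧ (v ∈ C' m ∧ v ∉ C m) ∧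
    ((u < v ∧ ∀ t : ℕ, u < t → t ≤ v → below (C' m) t < below (C m) t) ∨
      (v < u ∧ ∀ t : ℕ, v < t → t ≤ u → below (C m) t < below (C' m) t))

/-- A row in which `C` has a box of column `m` that `C'` lacks starts a shift. -/
theorem exists_shift {C C' : ι → Finset (Fin n)} {m : ι} (hcard : (C m).card = (C' m).card)
    {u : Fin n} (hu : u ∈ C m) (hu' : u ∉ C' m) : ∃ v, Shift C C' m u v := by
  classical
  have h1 := below_succ (C m) u
  have h2 := below_succ (C' m) u
  rw [if_pos hu] at h1
  rw [if_neg hu'] at h2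
  by_cases hpos : below (C' m) (u + 1) < below (C m) (u + 1)
  · -- the first later time at which the excess of `C` is gone
    have hex : ∃ t : ℕ, u < t ∧ below (C m) t ≤ below (C' m) t :=
      ⟨n, u.2, by rw [below_last, below_last, hcard]⟩
    obtain ⟨ht, hle⟩ := Nat.find_spec hex
    have hmin := fun s => Nat.find_min (H := hex) (m := s)
    have htn : Nat.find hex ≤ n :=
      Nat.find_min' hex ⟨u.2, by rw [below_last, below_last, hcard]⟩
    generalize Nat.find hex = t at *
    obtain ⟨s, rfl⟩ : ∃ s, t = s + 1 := ⟨t - 1, by omega⟩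
    have hus : (u : ℕ) < s := by
      rcases Nat.lt_succ_iff_lt_or_eq.mp ht with h | h
      · exact h
      · rw [← h] at hle
        omega
    have hall : ∀ t : ℕ, u < t → t ≤ s → below (C' m) t < below (C m) t := by
      intro t h3 h4
      have := hmin t (by omega)
      push Not at this
      exact this h3
    have hs := hall s hus le_rfl
    have h3 := below_succ (C m) ⟨s, htn⟩
    have h4 := below_succ (C' m) ⟨s, htn⟩
    simp only at h3 h4
    refine ⟨⟨s, htn⟩, ⟨hu, hu'⟩, ?_, Or.inl ⟨hus, hall⟩⟩
    split_ifs at h3 h4 with h5 h6 h6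
    · omega
    · omega
    · exact ⟨h6, h5⟩
    · omega
  · -- the last earlier time at which `C'` had no excess
    have hneg : below (C m) u < below (C' m) u := by omega
    let s := Nat.findGreatest (fun t => below (C' m) t ≤ below (C m) t) u
    have hs : below (C' m) s ≤ below (C m) s :=
      Nat.findGreatest_spec (P := fun t => below (C' m) t ≤ below (C m) t) (Nat.zero_le u)
        (by simp [below_zero])
    have hsu : s ≤ u := Nat.findGreatest_le _
    have hsu' : s < u := by
      rcases hsu.lt_or_eq with h | h
      · exact h
      · rw [h] at hs
        omega
    have hall : ∀ t : ℕ, s < t → t ≤ u → below (C m) t < below (C' m) t := by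
      intro t h3 h4
      have := Nat.findGreatest_is_greatest h3 h4
      omega
    have hs1 := hall (s + 1) (by omega) hsu'
    have hsn : s < n := hsu'.trans u.2
    have h3 := below_succ (C m) ⟨s, hsn⟩
    have h4 := below_succ (C' m) ⟨s, hsn⟩
    simp only at h3 h4
    refine ⟨⟨s, hsn⟩, ⟨hu, hu'⟩, ?_, Or.inr ⟨hsu', hall⟩⟩
    split_ifs at h3 h4 with h5 h6 h6
    · omega
    · omega
    · exact ⟨h6, h5⟩
    · omega

/-- If `C` and `C'` have equal row sums, then a row with a box of `C'` outside `C` also has a box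
of `C` outside `C'`. -/
theorem exists_mem_of_rowSum_eq [Fintype ι] {C C' : ι → Finset (Fin n)} {i : Fin n}
    (h : rowSum C i = rowSum C' i) {m : ι} (hm : i ∈ C' m) (hm' : i ∉ C m) :
    ∃ j, i ∈ C j ∧ i ∉ C' j := by
  by_contra! hall
  have : (Finset.univ.filter fun j => i ∈ C j) ⊂ Finset.univ.filter fun j => i ∈ C' j := by
    refine Finset.ssubset_iff_subset_ne.mpr ⟨fun j hj => ?_, fun heq => ?_⟩
    · simp only [Finset.mem_filter, Finset.mem_univ, true_and] at hj ⊢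
      exact hall j hj
    · have : m ∈ Finset.univ.filter fun j => i ∈ C j := by
        rw [heq]
        simpa using hm
      exact hm' (by simpa using this)
  exact (Finset.card_lt_card this).ne h

/-- Two different families with the same row sums admit an exchange, in one of them, which brings
them closer together. The shifts form a directed graph on the rows; on a minimal nonempty set `W`
of rows which every row of `W` can leave only for a row of `W` the shifts form a chordless cycle,
and one looks at the two shifts ending and starting at the top row of `W`. -/
theorem exists_exchange [Fintype ι] [DecidableEq ι] {D C C' : ι → Finset (Fin n)}
    (hC : ∀ i, GaleLE (C i) (D i)) (hC' : ∀ i, GaleLE (C' i) (D i)) (hrow : ∀ i, rowSum C i = rowSum C' i)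
    (hne : C ≠ C') :
    ∃ j k u v,
      (Exchangeable D C j k u v ∧ area (exchange C j k u v) C' < area C C') ∨
      (Exchangeable D C' j k u v ∧ area C (exchange C' j k u v) < area C C') := by
  classical
  have hcard : ∀ m, (C m).card = (C' m).card := fun m => (hC m).fst.trans (hC' m).fst.symm
  -- sets of rows in which every row starts a shift to a row of the set
  let closed : Finset (Fin n) → Prop := fun W =>
    W.Nonempty ∧ ∀ u ∈ W, ∃ v ∈ W, ∃ m, Shift C C' m u v
  have hex : ∃ W, closed W := by
    have hstep : ∀ u, (∃ m, u ∈ C m ∧ u ∉ C' m) →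
        ∃ v, (∃ m, v ∈ C m ∧ v ∉ C' m) ∧ ∃ m, Shift C C' m u v := by
      rintro u ⟨m, hu, hu'⟩
      obtain ⟨v, hv⟩ := exists_shift (hcard m) hu hu'
      exact ⟨v, exists_mem_of_rowSum_eq (hrow v) hv.2.1.1 hv.2.1.2, m, hv⟩
    refine ⟨Finset.univ.filter fun u => ∃ m, u ∈ C m ∧ u ∉ C' m, ?_, fun u hu => ?_⟩
    · obtain ⟨m, hm⟩ := Function.ne_iff.mp hne
      have : ¬ C m ⊆ C' m := fun h => hm (Finset.eq_of_subset_of_card_le h (hcard m).ge)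
      obtain ⟨u, hu, hu'⟩ := Finset.not_subset.mp this
      exact ⟨u, by simpa using ⟨m, hu, hu'⟩⟩
    · obtain ⟨v, hv, hs⟩ := hstep u (by simpa using hu)
      exact ⟨v, by simpa using hv, hs⟩
  obtain ⟨W, hW⟩ := exists_minimal_of_wellFoundedLT closed hex
  obtain ⟨⟨hWne, hWstep⟩, hmin⟩ := hW
  choose! N hNW hN using hWstep
  -- by minimality the successor map `N` permutes `W`
  have himage : W.image N = W := by
    have hsub : W.image N ⊆ W := by
      intro x hx
      obtain ⟨u, hu, rfl⟩ := Finset.mem_image.mp hx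
      exact hNW u hu
    exact hsub.antisymm (hmin ⟨hWne.image N, fun u hu =>
      ⟨N u, Finset.mem_image_of_mem N (hsub hu), hN u (hsub hu)⟩⟩ hsub)
  have hinj : Set.InjOn N W := by
    rw [← Finset.card_image_iff, himage]
  -- no chord can bypass a row of the cycle
  have hchord : ∀ r ∈ W, ∀ a ∈ W, ∀ b ∈ W, N a = r → a ≠ r → b ≠ r → ∀ m, ¬ Shift C C' m a b := by
    intro r hr a ha b hb har hne hbr m hs
    have : closed (W.erase r) := by
      refine ⟨⟨b, Finset.mem_erase.mpr ⟨hbr, hb⟩⟩, fun w hw => ?_⟩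
      obtain ⟨hwr, hwW⟩ := Finset.mem_erase.mp hw
      by_cases hwa : w = a
      · subst hwa
        exact ⟨b, Finset.mem_erase.mpr ⟨hbr, hb⟩, m, hs⟩
      · refine ⟨N w, Finset.mem_erase.mpr ⟨fun h => hwa (hinj hwW ha (h.trans har.symm)),
          hNW w hwW⟩, hN w hwW⟩
    exact Finset.notMem_erase r W (hmin this (Finset.erase_subset r W) hr)
  obtain ⟨r, hr, hrmin⟩ := W.exists_min_image id hWne
  obtain ⟨s', hs'W, hs'r⟩ : ∃ s' ∈ W, N s' = r := by
    rw [← himage] at hr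
    exact Finset.mem_image.mp hr
  obtain ⟨m, hm⟩ := hN r hr
  obtain ⟨j, hj⟩ := hN s' hs'W
  have hsW := hNW r hr
  rw [hs'r] at hj
  generalize N r = s at *
  have hrs : r ≤ s := hrmin s hsW
  have hrs' : r ≤ s' := hrmin s' hs'W
  obtain ⟨⟨hm1, hm2⟩, ⟨hm3, hm4⟩, hm5⟩ := hm
  obtain ⟨⟨hj1, hj2⟩, ⟨hj3, hj4⟩, hj5⟩ := hj
  obtain ⟨hlt, hmlt⟩ := hm5.resolve_right fun h => absurd h.1 (not_lt.mpr hrs)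
  obtain ⟨hlt', hjlt⟩ := hj5.resolve_left fun h => absurd h.1 (not_lt.mpr hrs')
  clear hm5 hj5
  -- the exchanges of the rows `r < x` in the columns `m`, `j`
  have exC : ∀ x : Fin n, r < x → x ≤ s → x ≤ s' → x ∉ C m → x ∈ C j →
      Exchangeable D C m j r x ∧ area (exchange C m j r x) C' < area C C' := by
    intro x h1 h2 h3 h4 h5
    have e : Exchangeable D C m j r x := ⟨h1, hm1, h4, h5, hj4, fun t h6 h7 =>
      lt_of_le_of_lt ((galeLE_iff_below.mp (hC' m)).2 t) (hmlt t h6 (h7.trans h2))⟩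
    exact ⟨e, e.area_lt (fun t h6 h7 => hmlt t h6 (h7.trans h2))
      (fun t h6 h7 => hjlt t h6 (h7.trans h3))⟩
  have exC' : ∀ x : Fin n, r < x → x ≤ s → x ≤ s' → x ∈ C' m → x ∉ C' j →
      Exchangeable D C' j m r x ∧ area C (exchange C' j m r x) < area C C' := by
    intro x h1 h2 h3 h4 h5
    have e : Exchangeable D C' j m r x := ⟨h1, hj3, h5, h4, hm2, fun t h6 h7 =>
      lt_of_le_of_lt ((galeLE_iff_below.mp (hC j)).2 t) (hjlt t h6 (h7.trans h3))⟩
    refine ⟨e, ?_⟩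
    rw [area_comm C, area_comm C]
    exact e.area_lt (fun t h6 h7 => hjlt t h6 (h7.trans h3))
      (fun t h6 h7 => hmlt t h6 (h7.trans h2))
  rcases lt_trichotomy s s' with h | h | h
  · by_cases h1 : s ∈ C j
    · exact ⟨m, j, r, s, Or.inl (exC s hlt le_rfl h.le hm4 h1)⟩
    · by_cases h2 : s ∈ C' j
      · refine absurd ?_ (hchord r hr s' hs'W s hsW hs'r hlt'.ne' hlt.ne' j)
        exact ⟨⟨hj1, hj2⟩, ⟨h2, h1⟩, Or.inr ⟨h, fun t h3 h4 =>
          hjlt t (lt_trans (Fin.lt_def.mp hlt) h3) h4⟩⟩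
      · exact ⟨j, m, r, s, Or.inr (exC' s hlt le_rfl h.le hm3 h2)⟩
  · subst h
    exact ⟨m, j, r, s, Or.inl (exC s hlt le_rfl le_rfl hm4 hj1)⟩
  · by_cases h1 : s' ∈ C m
    · by_cases h2 : s' ∈ C' m
      · exact ⟨j, m, r, s', Or.inr (exC' s' hlt' h.le le_rfl h2 hj2)⟩
      · refine absurd ?_ (hchord r hr s' hs'W s hsW hs'r hlt'.ne' hlt.ne' m)
        exact ⟨⟨h1, h2⟩, ⟨hm3, hm4⟩, Or.inl ⟨h, fun t h3 h4 =>
          hmlt t (lt_trans (Fin.lt_def.mp hlt') h3) h4⟩⟩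
    · exact ⟨m, j, r, s', Or.inl (exC s' hlt' h.le le_rfl h1 hj1)⟩

/-- An equivalence relation which contains all exchanges contains all pairs of families with the
same row sums. -/
theorem rel_of_rowSum_eq [Fintype ι] [DecidableEq ι] {D : ι → Finset (Fin n)}
    {ρ : (ι → Finset (Fin n)) → (ι → Finset (Fin n)) → Prop} (hρ : Equivalence ρ)
    (hex : ∀ C j k u v, (∀ i, GaleLE (C i) (D i)) → Exchangeable D C j k u v →
      ρ C (exchange C j k u v))
    {C C' : ι → Finset (Fin n)} (hC : ∀ i, GaleLE (C i) (D i)) (hC' : ∀ i, GaleLE (C' i) (D i))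
    (hrow : ∀ i, rowSum C i = rowSum C' i) : ρ C C' := by
  induction h : area C C' using Nat.strong_induction_on generalizing C C' with
  | _ a ih =>
    subst h
    by_cases hne : C = C'
    · subst hne
      exact hρ.refl C
    obtain ⟨j, k, u, v, h | h⟩ := exists_exchange hC hC' hrow hne
    · exact hρ.trans (hex C j k u v hC h.1) (ih _ h.2 (h.1.galeLE hC) hC'
        (fun i => (h.1.rowSum i).trans (hrow i)) rfl)
    · exact hρ.trans (ih _ h.2 hC (h.1.galeLE hC')
        (fun i => (hrow i).trans (h.1.rowSum i).symm) rfl) (hρ.symm (hex C' j k u v hC' h.1))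

end Connectivity

/-! ### Exchanges between the two columns of a multiplicity-free pair -/

theorem below_Iic {n : ℕ} {R : Finset (Fin n)} {u : Fin n} (h : ∀ i ≤ u, i ∈ R) :
    below R (u + 1) = u + 1 := by
  have : (R.filter fun r : Fin n => (r : ℕ) < u + 1) = Finset.Iic u := by
    ext i
    simp only [Finset.mem_filter, Finset.mem_Iic, Nat.lt_succ_iff, Fin.val_fin_le]
    exact ⟨fun hi => hi.2, fun hi => ⟨h i hi, hi⟩⟩
  rw [below, this, Fin.card_Iic]

theorem below_Iio {n : ℕ} {R : Finset (Fin n)} {u : Fin n} (h : ∀ i < u, i ∈ R) :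
    below R u = u := by
  have : (R.filter fun r : Fin n => (r : ℕ) < u) = Finset.Iio u := by
    ext i
    simp only [Finset.mem_filter, Finset.mem_Iio, Fin.val_fin_lt]
    exact ⟨fun hi => hi.2, fun hi => ⟨h i hi, hi⟩⟩
  rw [below, this, Fin.card_Iio]

theorem exists_le_of_slack {n : ℕ} {X P : Finset (Fin n)} (hX : GaleLE X P) {t : ℕ}
    (h : below P t + 1 ≤ below X t) : ∃ p ∈ P, t ≤ (p : ℕ) := by
  by_contra! hall
  have h1 := below_of_le P hall
  have h2 := below_le_card X t
  have := hX.fst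
  omega

/-- A row of `Q` only, above a row of `P` only, above further elements of both columns, completes to
one of the configurations D, E, F. -/
theorem false_of_crossing {n : ℕ} {P Q : Finset (Fin n)} (hPQ : ¬ ContainsMultiplicitous P Q)
    (hQP : ¬ ContainsMultiplicitous Q P) {a b p q : Fin n} (haP : a ∉ P) (haQ : a ∈ Q)
    (hbP : b ∈ P) (hbQ : b ∉ Q) (hab : a < b) (hbp : b < p) (hbq : b < q) (hp : p ∈ P)
    (hq : q ∈ Q) : False := by
  by_cases hpQ : p ∈ Q
  · exact hPQ (.inr <| .inr <| .inr <| .inl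
      ⟨a, b, p, hab, hbp, ⟨haP, haQ⟩, ⟨hbP, hbQ⟩, hp, hpQ⟩)
  by_cases hqP : q ∈ P
  · exact hPQ (.inr <| .inr <| .inr <| .inl
      ⟨a, b, q, hab, hbq, ⟨haP, haQ⟩, ⟨hbP, hbQ⟩, hqP, hq⟩)
  rcases lt_trichotomy p q with h | h | h
  · exact hPQ (.inr <| .inr <| .inr <| .inr <| .inl
      ⟨a, b, p, q, hab, hbp, h, ⟨haP, haQ⟩, ⟨hbP, hbQ⟩, ⟨hp, hpQ⟩, hqP, hq⟩)
  · exact hpQ (h ▸ hq)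
  · exact hQP (.inr <| .inr <| .inr <| .inr <| .inr
      ⟨a, b, q, p, hab, hbq, h, ⟨haQ, haP⟩, ⟨hbQ, hbP⟩, ⟨hq, hqP⟩, hpQ, hp⟩)

/-- If both columns have room at row `u`, then some row up to `u` misses both: this is where the
configurations D, E, F are used. -/
theorem exists_common_gap {n : ℕ} {P Q X Z : Finset (Fin n)}
    (hPQ : ¬ ContainsMultiplicitous P Q) (hQP : ¬ ContainsMultiplicitous Q P)
    (hX : GaleLE X P) (hZ : GaleLE Z Q) {u : Fin n} (hXu : below P (u + 1) + 1 ≤ below X (u + 1))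
    (hZu : below Q (u + 1) + 1 ≤ below Z (u + 1)) : ∃ g ≤ u, g ∉ P ∧ g ∉ Q := by
  by_contra! hall
  have hgap : ∀ {R S : Finset (Fin n)}, below S (u + 1) + 1 ≤ below R (u + 1) → ∃ i ≤ u, i ∉ S := by
    intro R S h
    by_contra! h'
    have h1 := below_Iic h'
    have h2 := below_le R (u + 1)
    omega
  obtain ⟨a, hau, haP⟩ := hgap hXu
  obtain ⟨b, hbu, hbQ⟩ := hgap hZu
  have haQ := hall a hau haP
  have hbP : b ∈ P := by
    by_contra h
    exact hbQ (hall b hbu h)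
  obtain ⟨p, hp, hup⟩ := exists_le_of_slack hX hXu
  obtain ⟨q, hq, huq⟩ := exists_le_of_slack hZ hZu
  have hup' : u < p := hup
  have huq' : u < q := huq
  rcases lt_trichotomy a b with h | h | h
  · exact false_of_crossing hPQ hQP haP haQ hbP hbQ h (hbu.trans_lt hup') (hbu.trans_lt huq') hp hq
  · exact haP (h ▸ hbP)
  · exact false_of_crossing hQP hPQ hbQ hbP haQ haP h (hau.trans_lt huq') (hau.trans_lt hup') hq hp

/-- A minor factors at every row `c` before which `R` and `S` have equally many elements. -/
theorem associated_minor_cut {n : ℕ} {R S : Finset (Fin n)} (h : R.card = S.card) {c : ℕ}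
    (hc : below R c = below S c) :
    Associated (minor R S) (minor (R.filter fun r : Fin n => (r : ℕ) < c)
      (S.filter fun s : Fin n => (s : ℕ) < c) *
        minor (R.filter fun r : Fin n => ¬ (r : ℕ) < c)
          (S.filter fun s : Fin n => ¬ (s : ℕ) < c)) := by
  have h1 := Finset.card_filter_add_card_filter_not (s := R) (fun r : Fin n => (r : ℕ) < c)
  have h2 := Finset.card_filter_add_card_filter_not (s := S) (fun s : Fin n => (s : ℕ) < c)
  simp only [below] at hc
  conv_lhs => rw [← Finset.filter_union_filter_not_eq (fun r : Fin n => (r : ℕ) < c) R,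
    ← Finset.filter_union_filter_not_eq (fun s : Fin n => (s : ℕ) < c) S]
  refine associated_minor_union (Finset.disjoint_filter_filter_not _ _ _)
    (Finset.disjoint_filter_filter_not _ _ _) hc (by omega) fun s hs r hr => ?_
  rw [Finset.mem_filter] at hs hr
  exact Fin.lt_def.mpr (lt_of_lt_of_le hs.2 (not_lt.mp hr.2))

/-- A column in which `q` is the first element from row `u` on, and in which the larger rows all
lie below `q`, contributes the factor `y_{uq}`; moving `u` to `v` turns it into `y_{vq}`. -/
theorem exists_associated_single {n : ℕ} {X P : Finset (Fin n)} (hcard : X.card = P.card)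
    {u v q : Fin n} (huv : u < v) (hvq : v ≤ q) (huX : u ∈ X) (hq : q ∈ P)
    (hP : ∀ i ∈ P, u ≤ i → q ≤ i) (hbelow : below X u = below P u)
    (hX : ∀ r ∈ X, u < r → q < r) :
    ∃ K, Associated (minor X P) (K * minor {u} {q}) ∧
      Associated (minor (move X u v) P) (K * minor {v} {q}) := by
  have hvX : v ∉ X := fun h => absurd (hX v h huv) (not_lt.mpr hvq)
  have huq : u < q := huv.trans_le hvq
  have hbelow' : below (move X u v) u = below P u := by
    have := below_move huv huX hvX u
    rw [if_neg (by simp)] at this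
    omega
  have hT : (X.filter fun r => u < r).card = (P.filter fun s => q < s).card := by
    have h1 := Finset.card_filter_add_card_filter_not (s := X.filter fun r : Fin n => ¬ (r : ℕ) < u)
      (fun r => u < r)
    have h2 := Finset.card_filter_add_card_filter_not (s := P.filter fun r : Fin n => ¬ (r : ℕ) < u)
      (fun r => q < r)
    have h3 := Finset.card_filter_add_card_filter_not (s := X) (fun r : Fin n => (r : ℕ) < u)
    have h4 := Finset.card_filter_add_card_filter_not (s := P) (fun r : Fin n => (r : ℕ) < u)
    rw [Finset.filter_filter, Finset.filter_filter] at h1 h2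
    have e1 : (X.filter fun r : Fin n => ¬ (r : ℕ) < u ∧ u < r) = X.filter fun r => u < r :=
      Finset.filter_congr fun r _ => ⟨fun h => h.2, fun h => ⟨not_lt.mpr h.le, h⟩⟩
    have e2 : (X.filter fun r : Fin n => ¬ (r : ℕ) < u ∧ ¬ u < r) = {u} := by
      ext r
      simp only [Finset.mem_filter, Finset.mem_singleton, Fin.val_fin_lt, not_lt]
      exact ⟨fun h => le_antisymm h.2.2 h.2.1, fun h => by subst h; simp [huX]⟩
    have e3 : (P.filter fun r : Fin n => ¬ (r : ℕ) < u ∧ q < r) = P.filter fun r => q < r :=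
      Finset.filter_congr fun r _ => ⟨fun h => h.2, fun h => ⟨not_lt.mpr (huq.trans h).le, h⟩⟩
    have e4 : (P.filter fun r : Fin n => ¬ (r : ℕ) < u ∧ ¬ q < r) = {q} := by
      ext r
      simp only [Finset.mem_filter, Finset.mem_singleton, Fin.val_fin_lt, not_lt]
      exact ⟨fun h => le_antisymm h.2.2 (hP r h.1 h.2.1), fun h => by subst h; simp [hq, huq.le]⟩
    rw [e1, e2, Finset.card_singleton] at h1
    rw [e3, e4, Finset.card_singleton] at h2
    simp only [below] at hbelow
    omega
  -- both row sets have the shape `A ∪ {w} ∪ T`, where `w` is `u` or `v`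
  have key : ∀ (Y : Finset (Fin n)) (w : Fin n), Y.card = P.card → below Y u = below P u →
      (Y.filter fun r : Fin n => (r : ℕ) < u) = (X.filter fun r : Fin n => (r : ℕ) < u) →
      (Y.filter fun r : Fin n => ¬ (r : ℕ) < u) = {w} ∪ X.filter (fun r => u < r) →
      w ∉ X.filter (fun r => u < r) →
      Associated (minor Y P) (minor (X.filter fun r : Fin n => (r : ℕ) < u)
        (P.filter fun r : Fin n => (r : ℕ) < u) * minor (X.filter fun r => u < r)
          (P.filter fun r => q < r) * minor {w} {q}) := by
    intro Y w h1 h2 h3 h4 h5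
    refine (associated_minor_cut h1 h2).trans ?_
    have e : (P.filter fun r : Fin n => ¬ (r : ℕ) < u) = {q} ∪ P.filter (fun r => q < r) := by
      ext r
      simp only [Finset.mem_filter, Finset.mem_union, Finset.mem_singleton, Fin.val_fin_lt, not_lt]
      constructor
      · rintro ⟨h6, h7⟩
        rcases (hP r h6 h7).eq_or_lt with h8 | h8
        · exact Or.inl h8.symm
        · exact Or.inr ⟨h6, h8⟩
      · rintro (rfl | ⟨h6, h7⟩)
        · exact ⟨hq, huq.le⟩
        · exact ⟨h6, (huq.trans h7).le⟩
    rw [h3, h4, e, mul_assoc]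
    refine (Associated.refl _).mul_mul ?_
    rw [mul_comm]
    refine associated_minor_union ?_ ?_ rfl hT ?_
    · simpa using h5
    · simp
    · intro s hs r hr
      rw [Finset.mem_singleton] at hs
      rw [Finset.mem_filter] at hr
      rw [hs]
      exact hX r hr.1 hr.2
  refine ⟨_, key X u hcard hbelow rfl ?_ (by simp), key (move X u v) v
    ((card_move huX hvX).trans hcard) hbelow' ?_ ?_ (by simp [hvX])⟩
  · ext r
    simp only [Finset.mem_filter, Finset.mem_union, Finset.mem_singleton, Fin.val_fin_lt, not_lt]
    constructor
    · rintro ⟨h6, h7⟩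
      rcases h7.eq_or_lt with h8 | h8
      · exact Or.inl h8.symm
      · exact Or.inr ⟨h6, h8⟩
    · rintro (rfl | ⟨h6, h7⟩)
      · exact ⟨huX, le_rfl⟩
      · exact ⟨h6, h7.le⟩
  · ext r
    simp only [Finset.mem_filter, mem_move, Fin.val_fin_lt]
    constructor
    · rintro ⟨rfl | h6, h7⟩
      · exact absurd huv (not_lt.mpr h7.le)
      · exact ⟨h6.2, h7⟩
    · rintro ⟨h6, h7⟩
      exact ⟨Or.inr ⟨h7.ne, h6⟩, h7⟩
  · ext r
    simp only [Finset.mem_filter, Finset.mem_union, Finset.mem_singleton, Fin.val_fin_lt, not_lt,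
      mem_move]
    constructor
    · rintro ⟨rfl | h6, h7⟩
      · exact Or.inl rfl
      · exact Or.inr ⟨h6.2, lt_of_le_of_ne h7 (Ne.symm h6.1)⟩
    · rintro (rfl | ⟨h6, h7⟩)
      · exact ⟨Or.inl rfl, huv.le⟩
      · exact ⟨Or.inr ⟨h7.ne', h6⟩, h7.le⟩

/-- If `q` is the only element of `P` from row `u` on and there is room at `u`, then no element
of `X` lies beyond `u`. -/
theorem below_eq_of_last {n : ℕ} {X P : Finset (Fin n)} (hX : GaleLE X P) {u q : Fin n}
    (huX : u ∈ X) (hq : q ∈ P) (huq : u < q) (hmax : ∀ i ∈ P, i ≤ q)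
    (hP : ∀ i ∈ P, u ≤ i → q ≤ i) (hslack : below P (u + 1) + 1 ≤ below X (u + 1)) :
    below X u = below P u ∧ ∀ r ∈ X, ¬ u < r := by
  have h1 : below P (u + 1) = below P u := by
    have := below_succ P u
    rwa [if_neg fun h => absurd (hP u h le_rfl) (not_le.mpr huq)] at this
  have h2 : P.card = below P u + 1 := by
    have h3 : P = insert q (P.filter fun r : Fin n => (r : ℕ) < u) := by
      ext i
      simp only [Finset.mem_insert, Finset.mem_filter, Fin.val_fin_lt]
      constructor
      · intro hi
        by_cases h : i < u
        · exact Or.inr ⟨hi, h⟩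
        · exact Or.inl (le_antisymm (hmax i hi) (hP i hi (not_lt.mp h)))
      · rintro (rfl | h)
        · exact hq
        · exact h.1
    conv_lhs => rw [h3]
    rw [Finset.card_insert_of_notMem, below]
    simp [huq.le]
  have h3 := below_succ X u
  rw [if_pos huX] at h3
  have h4 := below_le_card X (u + 1)
  have h5 := hX.fst
  refine ⟨by omega, fun r hr hur => ?_⟩
  have h6 : (X.filter fun r : Fin n => (r : ℕ) < u + 1) = X :=
    Finset.eq_of_subset_of_card_le (Finset.filter_subset _ _) (by simp only [below] at *; omega)
  rw [← h6, Finset.mem_filter] at hr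
  have : (u : ℕ) < r := hur
  omega

/-- A column which up to row `c` misses only the row `g` forces its row set to miss, up to `c`,
only one row as well. -/
theorem filter_eq_of_initial {n : ℕ} {X P : Finset (Fin n)} (hX : GaleLE X P) {g v : Fin n} {c : ℕ}
    (hgc : (g : ℕ) < c) (hvc : (v : ℕ) < c) (hP : ∀ i : Fin n, (i : ℕ) < c → (i ∈ P ↔ i ≠ g))
    (hv : v ∉ X) :
    (P.filter fun r : Fin n => (r : ℕ) < c) =
        (Finset.univ.filter fun r : Fin n => (r : ℕ) < c).erase g ∧
      (X.filter fun r : Fin n => (r : ℕ) < c) =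
        (Finset.univ.filter fun r : Fin n => (r : ℕ) < c).erase v := by
  have hPc : (P.filter fun r : Fin n => (r : ℕ) < c) =
      (Finset.univ.filter fun r : Fin n => (r : ℕ) < c).erase g := by
    ext i
    simp only [Finset.mem_filter, Finset.mem_erase, Finset.mem_univ, true_and]
    exact ⟨fun h => ⟨(hP i h.2).mp h.1, h.2⟩, fun h => ⟨(hP i h.2).mpr h.1, h.2⟩⟩
  refine ⟨hPc, Finset.eq_of_subset_of_card_le ?_ ?_⟩
  · intro i
    simp only [Finset.mem_filter, Finset.mem_erase, Finset.mem_univ, true_and]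
    exact fun h => ⟨fun h' => hv (h' ▸ h.1), h.2⟩
  · have h1 := (galeLE_iff_below.mp hX).2 c
    rw [below, below, hPc, Finset.card_erase_of_mem (by simpa using hgc)] at h1
    rwa [Finset.card_erase_of_mem (by simpa using hvc)]

/-- The case of `associated_minor_exchange` in which the last element of `Q` is not below the last
element of `P`. Below a common gap `g ≤ u` the two columns agree up to the last element `q` of `Q`.
If they have no element in `[u, q)`, then `u` and `v` only contribute the factors `y_{uq}` and
`y_{vq}`. Otherwise `g` is the only row missing up to the last element before `q`, so that the row
sets `X` and `Z` have the same initial block, missing only `v`, or coincide altogether. -/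
theorem associated_minor_exchange_of_max_le {n : ℕ} {P Q X Z : Finset (Fin n)}
    (hPQ : ¬ ContainsMultiplicitous P Q) (hQP : ¬ ContainsMultiplicitous Q P)
    (hX : GaleLE X P) (hZ : GaleLE Z Q) {u v : Fin n} (huv : u < v) (huX : u ∈ X) (hvX : v ∉ X)
    (huZ : u ∈ Z) (hvZ : v ∉ Z)
    (hXs : ∀ t : ℕ, u < t → t ≤ v → below P t + 1 ≤ below X t)
    (hZs : ∀ t : ℕ, u < t → t ≤ v → below Q t + 1 ≤ below Z t)
    {p q : Fin n} (hp : p ∈ P) (hpmax : ∀ i ∈ P, i ≤ p) (hq : q ∈ Q) (hqmax : ∀ i ∈ Q, i ≤ q)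
    (hqp : q ≤ p) :
    Associated (minor X P * minor (move Z u v) Q) (minor (move X u v) P * minor Z Q) := by
  have huv' : (u : ℕ) < v := huv
  have hXu := hXs (u + 1) (Nat.lt_succ_self _) huv'
  have hZu := hZs (u + 1) (Nat.lt_succ_self _) huv'
  obtain ⟨g, hgu, hgP, hgQ⟩ := exists_common_gap hPQ hQP hX hZ hXu hZu
  have hvq : v ≤ q := by
    obtain ⟨q', hq', h⟩ := exists_le_of_slack hZ (hZs v huv' le_rfl)
    exact le_trans (Fin.le_def.mpr h) (hqmax q' hq')
  have huq : u < q := huv.trans_le hvq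
  have hgq : g < q := hgu.trans_lt huq
  -- configuration A: below the common gap `g` the two columns agree up to row `q`
  have hA : ∀ i j, g < i → i < j → i ∈ P → i ∉ Q → j ∉ Q := fun i j h1 h2 h3 h4 h5 =>
    hPQ (.inl ⟨g, i, j, h1, h2, ⟨hgP, hgQ⟩, ⟨h3, h4⟩, h5⟩)
  have hA' : ∀ i j, g < i → i < j → i ∈ Q → i ∉ P → j ∉ P := fun i j h1 h2 h3 h4 h5 =>
    hQP (.inl ⟨g, i, j, h1, h2, ⟨hgQ, hgP⟩, ⟨h3, h4⟩, h5⟩)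
  have hqP : q ∈ P := by
    by_contra h
    rcases hqp.eq_or_lt with h' | h'
    · exact h (h' ▸ hp)
    · exact hA' q p hgq h' hq h hp
  have hagree : ∀ i, g < i → i ≤ q → (i ∈ P ↔ i ∈ Q) := by
    intro i h1 h2
    rcases h2.eq_or_lt with rfl | h2
    · exact ⟨fun _ => hq, fun _ => hqP⟩
    · constructor
      · intro h
        by_contra h'
        exact hA i q h1 h2 h h' hq
      · intro h
        by_contra h'
        exact hA' i q h1 h2 h h' hqP
  have hC : ∀ i j k l, i < j → j < k → k < l → i ∉ P → i ∉ Q → j ∉ P → j ∉ Q → k ∈ P → k ∈ Q →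
      l ∉ P := fun i j k l h1 h2 h3 a b c d e f h =>
    hPQ (.inr <| .inr <| .inl ⟨i, j, k, l, h1, h2, h3, ⟨a, b⟩, ⟨c, d⟩, ⟨e, f⟩, h⟩)
  have hB : ∀ i k l, i < g → g < k → k < l → i ∉ P → i ∈ Q → k ∈ P → k ∈ Q →
      l ∉ P := fun i k l h1 h2 h3 a b e f h =>
    hPQ (.inr <| .inl ⟨i, g, k, l, h1, h2, h3, ⟨a, b⟩, ⟨hgP, hgQ⟩, ⟨e, f⟩, h⟩)
  have hB' : ∀ i k l, i < g → g < k → k < l → i ∈ P → i ∉ Q → k ∈ P → k ∈ Q →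
      l ∉ Q := fun i k l h1 h2 h3 a b e f h =>
    hQP (.inr <| .inl ⟨i, g, k, l, h1, h2, h3, ⟨b, a⟩, ⟨hgQ, hgP⟩, ⟨f, e⟩, h⟩)
  by_cases hI : ∀ i ∈ P, u ≤ i → q ≤ i
  · -- no element of the columns in `[u, q)`: the factors `y_{uq}` and `y_{vq}` are exchanged
    have hIQ : ∀ i ∈ Q, u ≤ i → q ≤ i := by
      intro i hi hui
      by_contra! h
      have hgi : g < i := lt_of_le_of_ne (hgu.trans hui) fun h' => hgQ (h' ▸ hi)
      exact absurd (hI i ((hagree i hgi h.le).mpr hi) hui) (not_le.mpr h)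
    have hZ' := below_eq_of_last hZ huZ hq huq hqmax hIQ hZu
    have hX' : below X u = below P u ∧ ∀ r ∈ X, u < r → q < r := by
      rcases hqp.eq_or_lt with rfl | hlt
      · have := below_eq_of_last hX huX hqP huq hpmax hI hXu
        exact ⟨this.1, fun r hr h => absurd h (this.2 r hr)⟩
      · have hfull : ∀ i, g < i → i < q → i ∈ P := by
          intro i h1 h2
          by_contra h
          exact hC g i q p h1 h2 hlt hgP hgQ h (fun h' => h ((hagree i h1 h2.le).mpr h')) hqP hq hp
        have hgap : ∀ i, u ≤ i → i < q → i ≤ g := by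
          intro i h1 h2
          by_contra! h
          exact absurd (hI i (hfull i h h2) h1) (not_le.mpr h2)
        have hgu' : u = g := le_antisymm (hgap u le_rfl huq) hgu
        have hvq' : v = q := by
          by_contra h
          exact absurd (hgap v huv.le (lt_of_le_of_ne hvq h)) (not_le.mpr (hgu' ▸ huv))
        constructor
        · have h1 : below P u = u := below_Iio fun i hi => by
            rw [hgu'] at hi
            by_contra h
            by_cases h' : i ∈ Q
            · exact hB i q p hi hgq hlt h h' hqP hq hp
            · exact hC i g q p hi hgq hlt h h' hgP hgQ hqP hq hp
          have h2 := (galeLE_iff_below.mp hX).2 u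
          have h3 := below_le X u
          omega
        · intro r hr hur
          by_contra! h
          have hrq : r < q := lt_of_le_of_ne h fun h' => hvX (hvq' ▸ h' ▸ hr)
          exact absurd (hgap r hur.le hrq) (not_le.mpr (hgu' ▸ hur))
    obtain ⟨K, hK, hK'⟩ := exists_associated_single hX.fst huv hvq huX hqP hI hX'.1 hX'.2
    obtain ⟨M, hM, hM'⟩ := exists_associated_single hZ.fst huv hvq huZ hq hIQ hZ'.1
      fun r hr h => absurd h (hZ'.2 r hr)
    refine (hK.mul_mul hM').trans (Associated.symm ?_)
    convert hK'.mul_mul hM using 1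
    ring
  · -- `e` is the last element of the columns before `q`; the columns miss only `g` up to row `e`
    push Not at hI
    obtain ⟨e₀, he₀, hue₀, he₀q⟩ := hI
    obtain ⟨e, he, hemax⟩ := (P.filter fun i => i < q).exists_max_image id
      ⟨e₀, Finset.mem_filter.mpr ⟨he₀, he₀q⟩⟩
    obtain ⟨heP, heq⟩ := Finset.mem_filter.mp he
    have hue : u ≤ e := hue₀.trans (hemax e₀ (Finset.mem_filter.mpr ⟨he₀, he₀q⟩))
    have hge : g < e := lt_of_le_of_ne (hgu.trans hue) fun h => hgP (h ▸ heP)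
    have heQ : e ∈ Q := (hagree e hge heq.le).mp heP
    have hefull : ∀ i, i ≤ e → i ≠ g → i ∈ P ∧ i ∈ Q := by
      intro i h1 h2
      rcases lt_or_gt_of_ne h2 with h | h
      · by_cases h3 : i ∈ P <;> by_cases h4 : i ∈ Q
        · exact ⟨h3, h4⟩
        · exact absurd hq (hB' i e q h hge heq h3 h4 heP heQ)
        · exact absurd hqP (hB i e q h hge heq h3 h4 heP heQ)
        · exact absurd hqP (hC i g e q h hge heq h3 h4 hgP hgQ heP heQ)
      · have h5 : i ∈ P := by
          rcases h1.eq_or_lt with rfl | h1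
          · exact heP
          · by_contra h3
            exact hC g i e q h h1 heq hgP hgQ h3
              (fun h' => h3 ((hagree i h (h1.trans heq).le).mpr h')) heP heQ hqP
        exact ⟨h5, (hagree i h (h1.trans heq.le)).mp h5⟩
    have hempty : ∀ i, e < i → i < q → i ∉ P ∧ i ∉ Q := by
      intro i h1 h2
      have h3 : i ∉ P := fun h => absurd (hemax i (Finset.mem_filter.mpr ⟨h, h2⟩)) (not_le.mpr h1)
      exact ⟨h3, fun h => h3 ((hagree i (hge.trans h1) h2.le).mpr h)⟩
    have heq' : (e : ℕ) < q := heq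
    by_cases hII : v ≤ e ∨ (q : ℕ) = e + 1
    · -- the blocks of both row sets up to row `c` agree and are exchanged
      obtain ⟨c, hvc, hgc, hc⟩ : ∃ c : ℕ, (v : ℕ) < c ∧ (g : ℕ) < c ∧
          ∀ i : Fin n, (i : ℕ) < c → ((i ∈ P ↔ i ≠ g) ∧ (i ∈ Q ↔ i ≠ g)) := by
        by_cases hqe : (q : ℕ) = e + 1
        · refine ⟨q + 1, Nat.lt_succ_of_le hvq, Nat.lt_succ_of_lt hgq, fun i hi => ?_⟩
          by_cases hig : i = g
          · subst hig
            simp [hgP, hgQ]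
          · have : i ∈ P ∧ i ∈ Q := by
              by_cases hiq : i = q
              · subst hiq
                exact ⟨hqP, hq⟩
              · have : (i : ℕ) ≠ q := fun h => hiq (Fin.ext h)
                exact hefull i (Fin.le_def.mpr (by omega)) hig
            simp [this, hig]
        · have hve : v ≤ e := hII.resolve_right hqe
          refine ⟨e + 1, Nat.lt_succ_of_le hve, Nat.lt_succ_of_lt hge, fun i hi => ?_⟩
          by_cases hig : i = g
          · subst hig
            simp [hgP, hgQ]
          · have := hefull i (Fin.le_def.mpr (by omega)) hig
            simp [this, hig]
      have hXc := filter_eq_of_initial hX hgc hvc (fun i hi => (hc i hi).1) hvX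
      have hZc := filter_eq_of_initial hZ hgc hvc (fun i hi => (hc i hi).2) hvZ
      have hsplit : ∀ {Y S : Finset (Fin n)}, GaleLE Y S → u ∈ Y → v ∉ Y →
          (S.filter fun r : Fin n => (r : ℕ) < c) =
            (Finset.univ.filter fun r : Fin n => (r : ℕ) < c).erase g ∧
          (Y.filter fun r : Fin n => (r : ℕ) < c) =
            (Finset.univ.filter fun r : Fin n => (r : ℕ) < c).erase v →
          ∃ K, Associated (minor Y S)
            (K * minor ((Finset.univ.filter fun r : Fin n => (r : ℕ) < c).erase v)
              ((Finset.univ.filter fun r : Fin n => (r : ℕ) < c).erase g)) ∧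
            Associated (minor (move Y u v) S)
            (K * minor ((Finset.univ.filter fun r : Fin n => (r : ℕ) < c).erase u)
              ((Finset.univ.filter fun r : Fin n => (r : ℕ) < c).erase g)) := by
        rintro Y S hYS huY hvY ⟨hSc, hYc⟩
        have hb : below Y c = below S c := by
          rw [below, below, hSc, hYc, Finset.card_erase_of_mem (by simpa using hvc),
            Finset.card_erase_of_mem (by simpa using hgc)]
        have hb' : below (move Y u v) c = below S c := by
          have := below_move huv huY hvY c
          rw [if_neg (by omega)] at this
          omega
        have h1 := associated_minor_cut hYS.fst hb
        have h2 := associated_minor_cut ((card_move huY hvY).trans hYS.fst) hb'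
        have e1 : ((move Y u v).filter fun r : Fin n => (r : ℕ) < c) =
            (Finset.univ.filter fun r : Fin n => (r : ℕ) < c).erase u := by
          ext i
          have := Finset.ext_iff.mp hYc i
          simp only [Finset.mem_filter, Finset.mem_erase, Finset.mem_univ, true_and,
            mem_move] at this ⊢
          by_cases hiv : i = v
          · subst hiv
            simp [hvc, huv.ne']
          · simp only [hiv, false_or, not_false_eq_true, true_and, ne_eq] at this ⊢
            tauto
        have e2 : ((move Y u v).filter fun r : Fin n => ¬ (r : ℕ) < c) =
            Y.filter fun r : Fin n => ¬ (r : ℕ) < c := by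
          ext i
          simp only [Finset.mem_filter, mem_move]
          constructor
          · rintro ⟨rfl | h, h'⟩
            · exact absurd hvc h'
            · exact ⟨h.2, h'⟩
          · rintro ⟨h, h'⟩
            refine ⟨Or.inr ⟨?_, h⟩, h'⟩
            rintro rfl
            exact h' (huv'.trans hvc)
        rw [hSc, hYc, mul_comm] at h1
        rw [hSc, e1, e2, mul_comm] at h2
        exact ⟨_, h1, h2⟩
      obtain ⟨K, hK, hK'⟩ := hsplit hX huX hvX hXc
      obtain ⟨M, hM, hM'⟩ := hsplit hZ huZ hvZ hZc
      refine (hK.mul_mul hM').trans (Associated.symm ?_)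
      convert hK'.mul_mul hM using 1
      ring
    · -- the columns coincide, and so do the row sets
      push Not at hII
      obtain ⟨hev, hqe⟩ := hII
      have hev' : (e : ℕ) < v := hev
      have hqn := q.2
      have hpq : p = q := by
        by_contra h
        have hlt : q < p := lt_of_le_of_ne hqp (Ne.symm h)
        let i : Fin n := ⟨e + 1, by omega⟩
        have h1 : e < i := Fin.lt_def.mpr (Nat.lt_succ_self _)
        have h2 : i < q := Fin.lt_def.mpr (show (e : ℕ) + 1 < q by omega)
        exact hC g i q p (hge.trans h1) h2 hlt hgP hgQ (hempty i h1 h2).1 (hempty i h1 h2).2 hqP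
          hq hp
      subst hpq
      have hmem : ∀ i, i ∈ P ↔ i = p ∨ (i ≤ e ∧ i ≠ g) := by
        intro i
        constructor
        · intro hi
          by_cases h1 : i = p
          · exact Or.inl h1
          · refine Or.inr ⟨?_, fun h => hgP (h ▸ hi)⟩
            exact hemax i (Finset.mem_filter.mpr ⟨hi, lt_of_le_of_ne (hpmax i hi) h1⟩)
        · rintro (rfl | h)
          · exact hqP
          · exact (hefull i h.1 h.2).1
      have hPQeq : P = Q := by
        ext i
        constructor
        · intro hi
          rcases (hmem i).mp hi with rfl | h
          · exact hq
          · exact (hefull i h.1 h.2).2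
        · intro hi
          rcases lt_trichotomy i g with h | h | h
          · exact (hefull i (h.trans hge).le h.ne).1
          · exact absurd (h ▸ hi) hgQ
          · exact (hagree i h (hqmax i hi)).mpr hi
      subst hPQeq
      have hPeq : P = insert p ((Finset.Iic e).erase g) := by
        ext i
        rw [hmem]
        simp only [Finset.mem_insert, Finset.mem_erase, Finset.mem_Iic]
        tauto
      have hPcard : P.card = e + 1 := by
        rw [hPeq, Finset.card_insert_of_notMem (by simp [heq]),
          Finset.card_erase_add_one (by simpa using hge.le), Fin.card_Iic]
      have hPbelow : below P (e + 1) = e := by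
        have h1 := below_last P
        have : (P.filter fun r : Fin n => (r : ℕ) < e + 1) = P.erase p := by
          ext i
          simp only [Finset.mem_filter, Finset.mem_erase, Nat.lt_succ_iff, Fin.val_fin_le]
          constructor
          · rintro ⟨h, h'⟩
            exact ⟨(h'.trans_lt heq).ne, h⟩
          · rintro ⟨h, h'⟩
            exact ⟨h', (((hmem i).mp h').resolve_left h).1⟩
        rw [below, this, Finset.card_erase_of_mem hp, hPcard, Nat.add_sub_cancel]
      have hIic : ∀ Y : Finset (Fin n), GaleLE Y P →
          (∀ t : ℕ, u < t → t ≤ v → below P t + 1 ≤ below Y t) → Y = Finset.Iic e := by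
        intro Y hY hs
        have h1 := hs (e + 1) (Nat.lt_succ_of_le hue) hev'
        have h2 : Y.card = e + 1 := hY.fst.trans hPcard
        have h3 : (Y.filter fun r : Fin n => (r : ℕ) < e + 1) = Y :=
          Finset.eq_of_subset_of_card_le (Finset.filter_subset _ _)
            (by simp only [below] at *; omega)
        refine Finset.eq_of_subset_of_card_le (fun i hi => ?_) (by rw [h2, Fin.card_Iic])
        rw [← h3, Finset.mem_filter] at hi
        exact Finset.mem_Iic.mpr (Fin.le_def.mpr (Nat.lt_succ_iff.mp hi.2))
      rw [hIic X hX hXs, hIic Z hZ hZs, mul_comm]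

/-- For the columns `P`, `Q` of a multiplicity-free pair, exchanging the rows `u` and `v` between
the two columns does not change the product of the minors up to a unit. -/
theorem associated_minor_exchange {n : ℕ} {P Q X Z : Finset (Fin n)}
    (hPQ : ¬ ContainsMultiplicitous P Q) (hQP : ¬ ContainsMultiplicitous Q P)
    (hX : GaleLE X P) (hZ : GaleLE Z Q) {u v : Fin n} (huv : u < v) (huX : u ∈ X) (hvX : v ∉ X)
    (huZ : u ∈ Z) (hvZ : v ∉ Z)
    (hXs : ∀ t : ℕ, u < t → t ≤ v → below P t + 1 ≤ below X t)
    (hZs : ∀ t : ℕ, u < t → t ≤ v → below Q t + 1 ≤ below Z t) :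
    Associated (minor X P * minor (move Z u v) Q) (minor (move X u v) P * minor Z Q) := by
  have hmax : ∀ {Y S : Finset (Fin n)}, GaleLE Y S →
      (∀ t : ℕ, u < t → t ≤ v → below S t + 1 ≤ below Y t) → ∃ p ∈ S, ∀ i ∈ S, i ≤ p := by
    intro Y S hY hs
    obtain ⟨p, hp, -⟩ := exists_le_of_slack hY (hs v huv le_rfl)
    exact S.exists_max_image id ⟨p, hp⟩
  obtain ⟨p, hp, hpmax⟩ := hmax hX hXs
  obtain ⟨q, hq, hqmax⟩ := hmax hZ hZs
  rcases le_total q p with h | h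
  · exact associated_minor_exchange_of_max_le hPQ hQP hX hZ huv huX hvX huZ hvZ hXs hZs hp hpmax
      hq hqmax h
  · have := associated_minor_exchange_of_max_le hQP hPQ hZ hX huv huZ hvZ huX hvX hZs hXs hq hqmax
      hp hpmax h
    rw [mul_comm, mul_comm (minor (move X u v) P)]
    exact this.symm

/-! ### Weight vectors and the character -/

/-- The weight of a diagram: the number of boxes in each row. -/
noncomputable def rowWeight {n : ℕ} (C : Diagram n) : Fin n →₀ ℕ :=
  Finsupp.equivFunOnFinite.symm (rowSum C.col)

theorem rowWeight_apply {n : ℕ} (C : Diagram n) (i : Fin n) : rowWeight C i = rowSum C.col i := rfl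

theorem diagramDet_eq {n : ℕ} {C D : Diagram n} (h : C.LE D) :
    diagramDet C D h = ∏ j, minor (C.col j) (D.col j) :=
  Finset.prod_congr rfl fun j _ => (minor_eq (h j).fst).symm

theorem diagramDet_ne_zero {n : ℕ} {C D : Diagram n} (h : C.LE D) : diagramDet C D h ≠ 0 :=
  Finset.prod_ne_zero_iff.mpr fun j _ => flagMinor_ne_zero (h j)

/-- For a multiplicity-free diagram, the spanning vectors of equal weight agree up to units. -/
theorem associated_diagramDet {n : ℕ} {D : Diagram n} (hD : D.MultiplicityFree) {C C' : Diagram n}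
    (h : C.LE D) (h' : C'.LE D) (hw : rowWeight C = rowWeight C') :
    Associated (diagramDet C D h) (diagramDet C' D h') := by
  rw [diagramDet_eq, diagramDet_eq]
  refine rel_of_rowSum_eq (D := D.col)
    (ρ := fun C C' => Associated (∏ j, minor (C j) (D.col j)) (∏ j, minor (C' j) (D.col j)))
    ⟨fun _ => Associated.refl _, fun h => h.symm, fun h₁ h₂ => h₁.trans h₂⟩ ?_ h h'
    fun i => DFunLike.congr_fun hw i
  intro C j k u v hC hex
  have hpair : ∀ {j k : Fin n}, j ≠ k → ¬ ContainsMultiplicitous (D.col j) (D.col k) := by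
    intro j k hjk hcon
    rcases lt_or_gt_of_ne hjk with hlt | hlt
    · exact hD ⟨j, k, hlt, .inl hcon⟩
    · exact hD ⟨k, j, hlt, .inr hcon⟩
  rw [prod_eq_mul_mul_prod _ hex.ne, prod_eq_mul_mul_prod
    (fun i => minor (exchange C j k u v i) (D.col i)) hex.ne, exchange_left hex.ne, exchange_right]
  refine Associated.mul_mul ?_ ?_
  · have hZ := (hC k).move_up hex.lt hex.notMem_right hex.mem_right
    have := associated_minor_exchange (hpair hex.ne) (hpair hex.ne.symm) (hC j) hZ hex.lt
      hex.mem_left hex.notMem_left (mem_move.mpr (.inl rfl))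
      (fun hv => (mem_move.mp hv).elim (fun e => hex.lt.ne' e) fun e => e.1 rfl) hex.slack
      (fun t h₁ h₂ => by
        rw [below_move' hex.lt hex.notMem_right hex.mem_right, if_pos ⟨h₁, h₂⟩]
        exact Nat.add_le_add_right ((galeLE_iff_below.mp (hC k)).2 t) 1)
    rwa [move_move hex.mem_right hex.notMem_right] at this
  · refine Associated.of_eq (Finset.prod_congr rfl fun i hi => ?_)
    simp only [Finset.mem_erase] at hi
    rw [exchange_of_ne hi.2.1 hi.1]

theorem borelAct_torus_flagMinor_eq {n : ℕ} (x : Fin n → ℂˣ) (R S : Finset (Fin n))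
    (h : R.card = S.card) :
    borelAct (torus x) (flagMinor R S h) = (∏ i ∈ R, ((x i)⁻¹ : ℂ)) • flagMinor R S h := by
  have hprod : ∏ i ∈ R, ((x i)⁻¹ : ℂ) = ∏ k, ((x (R.orderEmbOfFin h k))⁻¹ : ℂ) := by
    rw [← Finset.prod_coe_sort, ← (R.orderIsoOfFin h).toEquiv.prod_comp]
    rfl
  rw [hprod, flagMinor, AlgHom.map_det, MvPolynomial.smul_eq_C_mul, map_prod,
    ← Matrix.det_mul_column]
  congr 1
  ext1 a b
  simp [borelAct_torus_genericUpper]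

/-- The spanning vectors are eigenvectors of the diagonal matrices. -/
theorem borelAct_torus_diagramDet {n : ℕ} (x : Fin n → ℂˣ) {C D : Diagram n} (h : C.LE D) :
    borelAct (torus fun i => (x i)⁻¹) (diagramDet C D h) =
      (∏ i, (x i : ℂ) ^ rowWeight C i) • diagramDet C D h := by
  rw [diagramDet, map_prod,
    Finset.prod_congr rfl fun j _ => borelAct_torus_flagMinor_eq _ (C.col j) (D.col j) (h j).fst,
    Finset.prod_smul]
  congr 1
  have h1 : ∀ j, ∏ i ∈ C.col j, (((x i)⁻¹ : ℂˣ) : ℂ)⁻¹ =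
      ∏ i, if i ∈ C.col j then (x i : ℂ) else 1 := by
    intro j
    rw [Finset.prod_ite_mem, Finset.univ_inter]
    exact Finset.prod_congr rfl fun i _ => by simp
  rw [Finset.prod_congr rfl fun j _ => h1 j, Finset.prod_comm]
  refine Finset.prod_congr rfl fun i _ => ?_
  rw [rowWeight_apply, rowSum, ← Finset.prod_const, Finset.prod_filter]

/-- Polynomials are determined by their values on the torus. -/
theorem eq_of_eval_units {n : ℕ} {p q : MvPolynomial (Fin n) ℂ}
    (h : ∀ x : Fin n → ℂˣ, MvPolynomial.eval (fun i => (x i : ℂ)) p =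
      MvPolynomial.eval (fun i => (x i : ℂ)) q) : p = q := by
  refine MvPolynomial.funext_set (fun _ => {z : ℂ | z ≠ 0})
    (fun _ => (Set.finite_singleton (0 : ℂ)).infinite_compl) fun x hx => ?_
  exact h fun i => Units.mk0 (x i) (hx i (Set.mem_univ i))

section Basis

variable {n : ℕ} (D : Diagram n)

open scoped Classical in
/-- The weights of the diagrams `C ≤ D`. -/
noncomputable def weights : Finset (Fin n →₀ ℕ) :=
  (Finset.univ.filter fun C : Diagram n => C.LE D).image rowWeight

theorem mem_weights {a : Fin n →₀ ℕ} :
    a ∈ weights D ↔ ∃ C : Diagram n, C.LE D ∧ rowWeight C = a := by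
  simp [weights]

/-- A choice of a diagram `C ≤ D` of each weight. -/
noncomputable def weightRep (a : weights D) : Diagram n := ((mem_weights D).mp a.2).choose

theorem weightRep_le (a : weights D) : (weightRep D a).LE D :=
  ((mem_weights D).mp a.2).choose_spec.1

theorem rowWeight_weightRep (a : weights D) : rowWeight (weightRep D a) = a :=
  ((mem_weights D).mp a.2).choose_spec.2

/-- The spanning vector of the flagged Weyl module for the chosen diagram of a given weight. -/
noncomputable def weightVec (a : weights D) : flaggedWeyl D :=
  ⟨diagramDet (weightRep D a) D (weightRep_le D a),
    Submodule.subset_span ⟨_, weightRep_le D a, rfl⟩⟩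

theorem restrict_weightVec (x : Fin n → ℂˣ) (a : weights D) :
    (borelAct (torus fun i => (x i)⁻¹)).toLinearMap.restrict
        (borelAct_torus_mem_flaggedWeyl D fun i => (x i)⁻¹) (weightVec D a) =
      (∏ i, (x i : ℂ) ^ (a : Fin n →₀ ℕ) i) • weightVec D a := by
  apply Subtype.ext
  rw [LinearMap.coe_restrict_apply]
  have := borelAct_torus_diagramDet x (weightRep_le D a)
  rw [rowWeight_weightRep] at this
  exact this

/-- Applying all diagonal matrices to a linear relation and comparing coefficients in `ℂ[Y]`
gives, for each monomial of `ℂ[Y]`, a polynomial in `x` which vanishes on the torus. -/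
theorem linearIndependent_weightVec : LinearIndependent ℂ (weightVec D) := by
  rw [Fintype.linearIndependent_iff]
  intro c hc a
  obtain ⟨m, hm⟩ := MvPolynomial.ne_zero_iff.mp (diagramDet_ne_zero (weightRep_le D a))
  have hzero : ∑ b : weights D, MvPolynomial.monomial (b : Fin n →₀ ℕ)
      (c b * MvPolynomial.coeff m (weightVec D b : FlagPoly n)) = 0 := by
    refine eq_of_eval_units fun x => ?_
    have h1 := congrArg ((borelAct (torus fun i => (x i)⁻¹)).toLinearMap.restrict
      (borelAct_torus_mem_flaggedWeyl D fun i => (x i)⁻¹)) hc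
    rw [map_sum, map_zero] at h1
    have h2 := congrArg (fun f : flaggedWeyl D => MvPolynomial.coeff m (f : FlagPoly n)) h1
    simp only [map_smul, restrict_weightVec, Submodule.coe_sum, Submodule.coe_smul,
      MvPolynomial.coeff_sum, MvPolynomial.coeff_smul, smul_eq_mul, Submodule.coe_zero,
      MvPolynomial.coeff_zero] at h2
    rw [map_zero, map_sum, ← h2]
    refine Finset.sum_congr rfl fun b _ => ?_
    rw [MvPolynomial.eval_monomial, Finsupp.prod_fintype _ _ fun _ => pow_zero _]
    ring
  have h3 := congrArg (MvPolynomial.coeff (a : Fin n →₀ ℕ)) hzero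
  rw [MvPolynomial.coeff_sum, MvPolynomial.coeff_zero, Finset.sum_eq_single a] at h3
  · rw [MvPolynomial.coeff_monomial, if_pos rfl] at h3
    exact (mul_eq_zero.mp h3).resolve_right hm
  · intro b _ hb
    rw [MvPolynomial.coeff_monomial, if_neg fun h => hb (Subtype.ext h)]
  · simp

theorem span_weightVec (hD : D.MultiplicityFree) :
    ⊤ ≤ Submodule.span ℂ (Set.range (weightVec D)) := by
  rintro ⟨f, hf⟩ -
  have : f ∈ (Submodule.span ℂ (Set.range (weightVec D))).map (flaggedWeyl D).subtype := by
    refine Submodule.span_le.mpr ?_ hf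
    rintro _ ⟨C, h, rfl⟩
    let a : weights D := ⟨rowWeight C, (mem_weights D).mpr ⟨C, h, rfl⟩⟩
    obtain ⟨w, hw⟩ := associated_diagramDet hD (weightRep_le D a) h (rowWeight_weightRep D a)
    -- the units of `ℂ[Y]` are the nonzero constants
    obtain ⟨c, -, hcw⟩ := MvPolynomial.isUnit_iff_eq_C_of_isReduced.mp w.isUnit
    refine ⟨c • weightVec D a, Submodule.smul_mem _ c (Submodule.subset_span ⟨a, rfl⟩), ?_⟩
    rw [← hw, hcw, mul_comm, ← MvPolynomial.smul_eq_C_mul]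
    rfl
  obtain ⟨g, hg, hgf⟩ := this
  have : g = ⟨f, hf⟩ := Subtype.ext hgf
  rwa [← this]

theorem isDualCharacter_sum_monomial (hD : D.MultiplicityFree) :
    IsDualCharacter D (∑ a ∈ weights D, MvPolynomial.monomial a 1) := by
  intro x
  let b := Module.Basis.mk (linearIndependent_weightVec D) (span_weightVec D hD)
  have hb : ∀ a, b a = weightVec D a := fun a => Module.Basis.mk_apply _ _ a
  rw [weylCharacter, LinearMap.trace_eq_matrix_trace ℂ b, Matrix.trace, map_sum,
    ← Finset.sum_coe_sort]
  refine Finset.sum_congr rfl fun a _ => ?_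
  rw [Matrix.diag_apply, LinearMap.toMatrix_apply, hb, restrict_weightVec, ← hb, map_smul,
    Module.Basis.repr_self, MvPolynomial.eval_monomial,
    Finsupp.prod_fintype _ _ fun _ => pow_zero _]
  simp

end Basis

/-- The dual character of the flagged Weyl module of a multiplicity-free diagram (it is a
well-defined polynomial) is zero-one. -/
theorem theorem1p1 (n : ℕ) (D : Diagram n) (hD : D.MultiplicityFree) :
    (∃! χ : MvPolynomial (Fin n) ℂ, IsDualCharacter D χ) ∧
      ∀ χ : MvPolynomial (Fin n) ℂ, IsDualCharacter D χ → IsZeroOne χ := by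
  have huniq : ∀ χ, IsDualCharacter D χ → χ = ∑ a ∈ weights D, MvPolynomial.monomial a 1 :=
    fun χ hχ => eq_of_eval_units fun x =>
      (hχ x).trans (isDualCharacter_sum_monomial D hD x).symm
  refine ⟨⟨_, isDualCharacter_sum_monomial D hD, huniq⟩, fun χ hχ a => ?_⟩
  rw [huniq χ hχ, MvPolynomial.coeff_sum]
  simp only [MvPolynomial.coeff_monomial, Finset.sum_ite_eq']
  split_ifs
  · exact Or.inr rfl
  · exact Or.inl rfl
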